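/- **Conventions.** Let $\mathcal C$ be a small site. A gerbe on $\mathcal C$ is a stack in groupoids over $\mathcal C$ which is locally non-empty and in which any two objects over the same object of $\mathcal C$ are locally isomorphic. For a faithful morphism $f:\mathcal G\to\mathcal H$ of gerbes and an object $s\in\mathcal G(S)$, the group sheaf $\underline{\mathrm{Aut}}_{\mathcal G}(s)$ on $\mathcal C/S$ is regarded as a subsheaf of $\underline{\mathrm{Aut}}_{\mathcal H}(f(s))$ through $f$. The normalizer of a subsheaf $A$ of a group sheaf $\Gamma$ on $\mathcal C/S$ is the subsheaf of groups of $\Gamma$ whose sections over $T\to S$ are the $n\in\Gamma(T)$ with $n\,A|_T\,n^{-1}=A|_T$. Two subsheaves $A,B\subseteq\Gamma$ are locally conjugate if there is a covering $\{U_i\to S\}$ and sections $\beta_i\in\Gamma(U_i)$ with $\beta_i\,A|_{U_i}\,\beta_i^{-1}=B|_{U_i}$ for all $i$. Two faithful morphisms of gerbes $f:\mathcal G\to\mathcal H$ and $f':\mathcal G'\to\mathcal H$ are locally equivalent if for every $S\in\mathcal C$, all $s\in\mathcal G(S)$, $s'\in\mathcal G'(S)$ and every isomorphism $\alpha:f(s)\to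 f'(s')$ in $\mathcal H(S)$, the subsheaves $\alpha\,\underline{\mathrm{Aut}}_{\mathcal G}(s)\,\alpha^{-1}$ and $\underline{\mathrm{Aut}}_{\mathcal G'}(s')$ of $\underline{\mathrm{Aut}}_{\mathcal H}(f'(s'))$ are locally conjugate. **Theorem.** Let $f:\mathcal G\to\mathcal H$ be a faithful morphism of gerbes on $\mathcal C$. There exist a gerbe $\mathcal N$ and a factorization $\mathcal G\xrightarrow{\phi}\mathcal N\xrightarrow{\psi}\mathcal H$ of $f$ (up to a $2$-isomorphism $\theta:\psi\circ\phi\cong f$), called the *normalizer* of $f$, such that: 1. $\phi$ and $\psi$ are faithful. 2. For every $S\in\mathcal C$ and every $s\in\mathcal G(S)$, the subsheaf $\underline{\mathrm{Aut}}_{\mathcal N}(\phi(s))$ of $\underline{\mathrm{Aut}}_{\mathcal H}(\psi(\phi(s)))$ is the normalizer of $\underline{\mathrm{Aut}}_{\mathcal G}(s)$ in $\underline{\mathrm{Aut}}_{\mathcal H}(\psi(\phi(s)))$. 3. The normalizer is unique: if $\mathcal G\xrightarrow{\phi'}\mathcal N'\xrightarrow{\psi'}\mathcal H$, with $\theta':\psi'\circ\phi'\cong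 f$, is another factorization of $f$ through a gerbe $\mathcal N'$ having properties (1) and (2), there exist an equivalence $e:\mathcal N\to\mathcal N'$ over $\mathcal C$ and $2$-isomorphisms $a:e\circ\phi\cong\phi'$ and $b:\psi'\circ e\cong\psi$ which are compatible with $\theta$ and $\theta'$, i.e. the two isomorphisms $\psi'\circ e\circ\phi\cong f$ obtained from $b,\theta$ and from $a,\theta'$ coincide. 4. If $f':\mathcal G'\to\mathcal H$ is a faithful morphism of gerbes locally equivalent to $f$, then $f$ and $f'$ have the same normalizer: for any normalizer $\mathcal G\to\mathcal N\xrightarrow{\psi}\mathcal H$ of $f$ there exists a faithful morphism $\phi':\mathcal G'\to\mathcal N$ such that $\mathcal G'\xrightarrow{\phi'}\mathcal N\xrightarrow{\psi}\mathcal H$ is the normalizer of $f'$, i.e. a factorization of $f'$ having properties (1) and (2). -/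

import Mathlib

open CategoryTheory

universe v u v₁ u₁ v₂ u₂ v₃ u₃ v₄ u₄ v₅ u₅

namespace GerbeNormalizer

variable {C : Type u} [Category.{v} C]

/-! ### Stacks in groupoids and gerbes

A category over `C` is a `BasedCategory C`, that is, a category `X.obj` with a projection
`X.p : X.obj ⥤ C`.  Morphisms are `BasedFunctor`s and `2`-morphisms are the morphisms of Mathlib's
category structure on `BasedFunctor X Y` (vertical natural transformations).  Over fibered
categories in groupoids every functor over `C` preserves cartesian arrows. -/

/-- `X` is a category fibered in groupoids over `C`: it is a fibered category, and the fiber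
category over every object of `C` is a groupoid. -/
class IsFiberedInGroupoids (X : BasedCategory.{v₁, u₁} C) : Prop where
  isFibered : X.p.IsFibered
  isGroupoid_fiber : ∀ S : C, IsGroupoid (X.p.Fiber S)

/-- A sieve on `S`, seen as a category over `C`: its objects are the arrows `T ⟶ S` of the sieve. -/
abbrev sieveBased {S : C} (R : Sieve S) : BasedCategory.{v, max u v} C where
  obj := R.arrows.category
  p := ObjectProperty.ι _ ⋙ Over.forget S

/-- `X` is a stack in groupoids for the topology `J`. In a category fibered in groupoids every arrow
`φ : c ⟶ x` exhibits `c` as a pullback of `x` along `X.p.map φ`, so no cleavage has to be chosen. -/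
class IsStackInGroupoids (J : GrothendieckTopology C) (X : BasedCategory.{v₁, u₁} C) : Prop
    extends IsFiberedInGroupoids X where
  /-- Morphisms form sheaves. Let `x`, `y` be objects over the same object `S` of `C` and `R` a
  covering sieve of `S`. A compatible family of morphisms from the restrictions of `x` along the
  arrows of `R` to the restrictions of `y` (that is, of arrows to `y` over the arrows of `R`) comes
  from a unique morphism `x ⟶ y` of the fiber over `S`. -/
  existsUnique_glue : ∀ (x y : X.obj), X.p.obj y = X.p.obj x →
    ∀ (R : Sieve (X.p.obj x)), R ∈ J (X.p.obj x) →
    ∀ (m : ∀ ⦃c : X.obj⦄ (φ : c ⟶ x), R (X.p.map φ) → (c ⟶ y)),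
      (∀ ⦃c : X.obj⦄ (φ : c ⟶ x) (h : R (X.p.map φ)), X.p.IsHomLift (X.p.map φ) (m φ h)) →
      (∀ ⦃c d : X.obj⦄ (φ : c ⟶ x) (l : d ⟶ c) (h : R (X.p.map φ))
        (h' : R (X.p.map (l ≫ φ))), m (l ≫ φ) h' = l ≫ m φ h) →
      ∃! μ : x ⟶ y, X.p.IsHomLift (𝟙 (X.p.obj x)) μ ∧
        ∀ ⦃c : X.obj⦄ (φ : c ⟶ x) (h : R (X.p.map φ)), φ ≫ μ = m φ h
  /-- Descent data are effective. A descent datum relative to a covering sieve `R` of `S` is a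
  functor `D` over `C` from `R` to `X`; it is effective if there is an object `x` over `S` with
  arrows `D f ⟶ x` over the arrows `f : T ⟶ S` of `R`, compatible with the morphisms of `R`. -/
  exists_descent : ∀ (S : C) (R : Sieve S), R ∈ J S → ∀ D : BasedFunctor (sieveBased R) X,
    ∃ (x : X.obj) (π : ∀ f : R.arrows.category, D.obj f ⟶ x), X.p.obj x = S ∧
      (∀ f : R.arrows.category, X.p.IsHomLift f.obj.hom (π f)) ∧
      ∀ ⦃f g : R.arrows.category⦄ (k : f ⟶ g), D.map k ≫ π g = π f

/-- `X` is a gerbe: a stack in groupoids which is locally non-empty and in which any two objects over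
the same base object are locally isomorphic. -/
class IsGerbe (J : GrothendieckTopology C) (X : BasedCategory.{v₁, u₁} C) : Prop
    extends IsStackInGroupoids J X where
  locally_nonempty : ∀ S : C, ∃ R ∈ J S, ∀ ⦃T : C⦄ (f : T ⟶ S), R f → Nonempty (X.p.Fiber T)
  /-- A common pullback `c` of `x` and `y` along `f` amounts to an isomorphism of the pullbacks. -/
  locally_isomorphic : ∀ (S : C) (x y : X.obj), X.p.obj x = S → X.p.obj y = S →
    ∃ R ∈ J S, ∀ ⦃T : C⦄ (f : T ⟶ S), R f →
      ∃ (c : X.obj) (φ : c ⟶ x) (ψ : c ⟶ y), X.p.IsHomLift f φ ∧ X.p.IsHomLift f ψ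

/-- A morphism over `C` is an equivalence if it has a quasi-inverse over `C`. -/
def IsEquivalenceOver {X : BasedCategory.{v₁, u₁} C} {Y : BasedCategory.{v₂, u₂} C}
    (E : BasedFunctor X Y) : Prop :=
  ∃ E' : BasedFunctor Y X, Nonempty (BasedFunctor.comp E E' ≅ BasedFunctor.id X) ∧
    Nonempty (BasedFunctor.comp E' E ≅ BasedFunctor.id Y)

/-! ### Automorphism sheaves and their subsheaves -/

/-- The group of automorphisms of `x` in the fiber category of `X` over `X.p.obj x`. -/
def VAut (X : BasedCategory.{v₁, u₁} C) (x : X.obj) : Subgroup (Aut x) where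
  carrier := {a | X.p.IsHomLift (𝟙 (X.p.obj x)) a.hom}
  one_mem' := IsHomLift.id rfl
  mul_mem' {a b} (ha : X.p.IsHomLift _ a.hom) (hb : X.p.IsHomLift _ b.hom) := by
    change X.p.IsHomLift _ (b.hom ≫ a.hom)
    infer_instance
  inv_mem' {a} (ha : X.p.IsHomLift _ a.hom) := IsHomLift.lift_id_inv X.p _ a

/-- The homomorphism `Aut(x) → Aut(F x)` induced by a morphism `F` over `C`. -/
def mapVAut {X : BasedCategory.{v₁, u₁} C} {Y : BasedCategory.{v₂, u₂} C} (F : BasedFunctor X Y)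
    (x : X.obj) : VAut X x →* VAut Y (F.obj x) where
  toFun a := ⟨F.toFunctor.mapIso a.1, by
    have : X.p.IsHomLift (𝟙 (X.p.obj x)) a.1.hom := a.2
    change Y.p.IsHomLift (𝟙 (Y.p.obj (F.obj x))) (F.map a.1.hom)
    rw [BasedFunctor.w_obj]
    infer_instance⟩
  map_one' := Subtype.ext (Iso.ext (F.toFunctor.map_id x))
  map_mul' a b := Subtype.ext (Iso.ext (F.toFunctor.map_comp b.1.hom a.1.hom))

/-- `b ∈ Aut(c)` is the restriction of `a ∈ Aut(x)` along the pullback arrow `l : c ⟶ x`. -/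
def IsRestriction {X : BasedCategory.{v₁, u₁} C} {c x : X.obj} (l : c ⟶ x) (b : VAut X c)
    (a : VAut X x) : Prop :=
  b.1.hom ≫ l = l ≫ a.1.hom

/-- Every arrow of a category fibered in groupoids is cartesian. -/
theorem isStronglyCartesian (X : BasedCategory.{v₁, u₁} C) [IsFiberedInGroupoids X] {c x : X.obj}
    (l : c ⟶ x) : X.p.IsStronglyCartesian (X.p.map l) l := by
  have := IsFiberedInGroupoids.isFibered (X := X)
  have := IsFiberedInGroupoids.isGroupoid_fiber (X := X) (X.p.obj c)
  obtain ⟨d, φ, hφ⟩ := Functor.IsPreFibered.exists_isCartesian' (p := X.p) (X.p.map l)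
  let t := Functor.IsCartesian.map X.p (X.p.map l) φ l
  have ht : IsIso t := by
    have h1 : IsIso (Functor.Fiber.homMk X.p (X.p.obj c) t) := inferInstance
    exact inferInstanceAs (IsIso (Functor.Fiber.fiberInclusion.map
      (Functor.Fiber.homMk X.p (X.p.obj c) t)))
  have h2 : X.p.IsStronglyCartesian (𝟙 (X.p.obj c) ≫ X.p.map l) (t ≫ φ) := inferInstance
  simpa [t] using h2

/-- Restriction of automorphisms is a well defined operation in a category fibered in groupoids. -/
theorem existsUnique_isRestriction (X : BasedCategory.{v₁, u₁} C) [IsFiberedInGroupoids X]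
    {c x : X.obj} (l : c ⟶ x) (a : VAut X x) : ∃! b : VAut X c, IsRestriction l b a := by
  have hl := isStronglyCartesian X l
  have key : ∀ a : VAut X x, ∃ b : c ⟶ c, X.p.IsHomLift (𝟙 (X.p.obj c)) b ∧ b ≫ l = l ≫ a.1.hom := by
    intro a
    have ha : X.p.IsHomLift (𝟙 (X.p.obj x)) a.1.hom := a.2
    exact (Functor.IsStronglyCartesian.universal_property X.p (X.p.map l) l (𝟙 (X.p.obj c))
      (X.p.map l) (by simp) (l ≫ a.1.hom)).exists
  obtain ⟨b, hb, hbl⟩ := key a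
  obtain ⟨b', hb', hbl'⟩ := key a⁻¹
  have e1 : a.1.hom ≫ (a⁻¹ : VAut X x).1.hom = 𝟙 x := a.1.hom_inv_id
  have e2 : (a⁻¹ : VAut X x).1.hom ≫ a.1.hom = 𝟙 x := a.1.inv_hom_id
  have uniq : ∀ f g : c ⟶ c, X.p.IsHomLift (𝟙 (X.p.obj c)) f → X.p.IsHomLift (𝟙 (X.p.obj c)) g →
      f ≫ l = g ≫ l → f = g := fun f g hf hg h =>
    Functor.IsStronglyCartesian.ext X.p (X.p.map l) l (𝟙 (X.p.obj c)) h
  refine ⟨⟨⟨b, b', ?_, ?_⟩, hb⟩, hbl, ?_⟩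
  · refine uniq _ _ inferInstance (IsHomLift.id rfl) ?_
    rw [Category.assoc, hbl', reassoc_of% hbl, e1, Category.comp_id, Category.id_comp]
  · refine uniq _ _ inferInstance (IsHomLift.id rfl) ?_
    rw [Category.assoc, hbl, reassoc_of% hbl', e2, Category.comp_id, Category.id_comp]
  · intro d hd
    ext
    exact uniq _ _ d.2 hb (hd.trans hbl.symm)

/-- A sub-presheaf of the automorphism sheaf of the object `x`, over `S` say. An object of the slice
`C / S` together with a pullback of `x` to it is an arrow `χ : c ⟶ x`, and the sections of the
automorphism sheaf there are the elements of `Aut(c)`. (The projection from the slice of `X.obj` over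
`x` to `C / S` is an equivalence if `X` is fibered in groupoids.) -/
@[ext]
structure AutSub (X : BasedCategory.{v₁, u₁} C) (x : X.obj) where
  sections : ∀ ⦃c : X.obj⦄, (c ⟶ x) → Set (VAut X c)
  restr_mem : ∀ ⦃c d : X.obj⦄ (χ : c ⟶ x) (l : d ⟶ c) (a : VAut X c) (b : VAut X d),
    IsRestriction l b a → a ∈ sections χ → b ∈ sections (l ≫ χ)

namespace AutSub

variable {X : BasedCategory.{v₁, u₁} C} {Y : BasedCategory.{v₂, u₂} C}

/-- The restriction of a sub-presheaf of the automorphism sheaf of `x` to a pullback of `x`. -/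
def restrict {x : X.obj} (A : AutSub X x) {c : X.obj} (χ : c ⟶ x) : AutSub X c where
  sections _ l := A.sections (l ≫ χ)
  restr_mem d e k l a b hab ha := by
    rw [Category.assoc]
    exact A.restr_mem (k ≫ χ) l a b hab ha

/-- For an isomorphism `α : x ≅ y` of the fiber category, the sub-presheaf `α A α⁻¹` of the
automorphism sheaf of `y`. If `χ : c ⟶ y` is a pullback of `y`, then `χ ≫ α⁻¹ : c ⟶ x` is a pullback
of `x`, and with respect to these pullbacks `α` restricts to the identity of `c`;
see `mem_conj_iff` for arbitrary pullbacks. -/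
def conj {x y : X.obj} (A : AutSub X x) (α : x ≅ y) : AutSub X y where
  sections _ χ := A.sections (χ ≫ α.inv)
  restr_mem c d χ l a b hab ha := by
    rw [Category.assoc]
    exact A.restr_mem (χ ≫ α.inv) l a b hab ha

/-- If `β : d ≅ c` is a restriction of `α` to pullbacks `d` of `x` and `c` of `y`, then the sections
of `α A α⁻¹` on `c` are the `β ∘ a ∘ β⁻¹` for `a` a section of `A` on `d`. -/
theorem mem_conj_iff {x y : X.obj} (A : AutSub X x) (α : x ≅ y) {c d : X.obj} (χ : c ⟶ y)
    (χ' : d ⟶ x) (β : d ≅ c) (h : β.hom ≫ χ = χ' ≫ α.hom) (e : VAut X c) :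
    e ∈ (A.conj α).sections χ ↔
      ∃ a ∈ A.sections χ', e.1.hom = β.inv ≫ a.1.hom ≫ β.hom := by
  have h1 : χ ≫ α.inv = β.inv ≫ χ' := by
    rw [Iso.comp_inv_eq, Category.assoc, ← h, Iso.inv_hom_id_assoc]
  constructor
  · intro he
    have he' : X.p.IsHomLift (𝟙 (X.p.obj c)) e.1.hom := e.2
    have h3 : X.p.map e.1.hom = 𝟙 (X.p.obj c) := by
      simpa using IsHomLift.fac' X.p (𝟙 (X.p.obj c)) e.1.hom
    let a : Aut d := β ≪≫ (e.1 : c ≅ c) ≪≫ β.symm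
    have ha : a ∈ VAut X d := by
      refine IsHomLift.of_fac' X.p _ _ rfl rfl ?_
      change X.p.map (β.hom ≫ e.1.hom ≫ β.inv) = _
      rw [X.p.map_comp, X.p.map_comp, h3, Category.id_comp, ← X.p.map_comp, β.hom_inv_id]
      simp
    have hah : a.hom = β.hom ≫ e.1.hom ≫ β.inv := rfl
    refine ⟨⟨a, ha⟩, ?_, by simp [hah]⟩
    have h2 := A.restr_mem (χ ≫ α.inv) β.hom e ⟨a, ha⟩ (by simp [IsRestriction, hah]) he
    rwa [h1, Iso.hom_inv_id_assoc] at h2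
  · rintro ⟨a, ha, hea⟩
    change e ∈ A.sections (χ ≫ α.inv)
    rw [h1]
    exact A.restr_mem χ' β.inv a e (by simp [IsRestriction, hea]) ha

/-- The image of the automorphism sheaf of `s` in the automorphism sheaf of `F s`. A section of the
latter on a pullback `χ : c ⟶ F s` belongs to it if `χ` factors as `c ⟶ F d ⟶ F s` with `d ⟶ s` a
pullback of `s`, and the section is the restriction to `c` of the image of an element of `Aut(d)`. -/
def image (F : BasedFunctor X Y) (s : X.obj) : AutSub Y (F.obj s) where
  sections c χ := {b | ∃ (d : X.obj) (χ' : d ⟶ s) (ι : c ⟶ F.obj d) (a : VAut X d),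
    ι ≫ F.map χ' = χ ∧ IsRestriction ι b (mapVAut F d a)}
  restr_mem := by
    rintro c c' χ l b b' hb ⟨d, χ', ι, a, rfl, hba⟩
    refine ⟨d, χ', l ≫ ι, a, by simp, ?_⟩
    simp only [IsRestriction] at *
    rw [reassoc_of% hb, hba, Category.assoc]

/-- The normalizer of `A` in the automorphism sheaf of `x`: a section `n` on a pullback `c` of `x`
belongs to it if `n A n⁻¹ = A` after restriction to every pullback of `c`. -/
def normalizer {x : X.obj} (A : AutSub X x) : AutSub X x where
  sections c χ := {n | ∀ ⦃d : X.obj⦄ (l : d ⟶ c) (m : VAut X d), IsRestriction l m n →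
    ∀ a : VAut X d, a ∈ A.sections (l ≫ χ) ↔ m * a * m⁻¹ ∈ A.sections (l ≫ χ)}
  restr_mem c d χ l n n' hn h e k m hm a := by
    have := h (k ≫ l) m (by
      simp only [IsRestriction] at *
      rw [reassoc_of% hm, hn, Category.assoc]) a
    simpa using this

/-- Two sub-presheaves of the automorphism sheaf of `x` are locally conjugate if there is a covering
sieve such that their restrictions along each of its arrows are conjugate by an automorphism. -/
def LocallyConjugate (J : GrothendieckTopology C) {x : X.obj} (A B : AutSub X x) : Prop :=
  ∃ R ∈ J (X.p.obj x), ∀ ⦃c : X.obj⦄ (χ : c ⟶ x), R (X.p.map χ) →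
    ∃ β : VAut X c, (A.restrict χ).conj β.1 = B.restrict χ

end AutSub

/-! ### Local equivalence and normalizers -/

/-- Local equivalence of (faithful) morphisms `F : G → H`, `F' : G' → H` of gerbes: for all objects
`s` of `G` and `s'` of `G'` over the same object `S` of `C`, and all isomorphisms `α : F s ≅ F' s'`
in the fiber of `H` over `S`, the subsheaves `α Aut(s) α⁻¹` and `Aut(s')` of `Aut(F' s')` are locally
conjugate. -/
def LocallyEquivalent (J : GrothendieckTopology C) {G : BasedCategory.{v₁, u₁} C}
    {G' : BasedCategory.{v₂, u₂} C} {H : BasedCategory.{v₃, u₃} C}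
    (F : BasedFunctor G H) (F' : BasedFunctor G' H) : Prop :=
  ∀ (S : C) (s : G.obj) (s' : G'.obj) (α : F.obj s ≅ F'.obj s'), H.p.IsHomLift (𝟙 S) α.hom →
    AutSub.LocallyConjugate J ((AutSub.image F s).conj α) (AutSub.image F' s')

/-- The properties required of a normalizer `G → N → H` of the composite morphism `G → H`: `N` is a
gerbe, both morphisms are faithful, and for every object `s` of `G` the automorphism sheaf of `Φ s` in
`N` is the normalizer of the automorphism sheaf of `s`, inside the automorphism sheaf of `Ψ (Φ s)`. -/
structure IsNormalizer (J : GrothendieckTopology C) {G : BasedCategory.{v₁, u₁} C}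
    {N : BasedCategory.{v₂, u₂} C} {H : BasedCategory.{v₃, u₃} C}
    (Φ : BasedFunctor G N) (Ψ : BasedFunctor N H) : Prop where
  isGerbe : IsGerbe J N
  faithful_left : Φ.toFunctor.Faithful
  faithful_right : Ψ.toFunctor.Faithful
  image_eq : ∀ s : G.obj,
    AutSub.image Ψ (Φ.obj s) = (AutSub.image (BasedFunctor.comp Φ Ψ) s).normalizer

end GerbeNormalizer

open GerbeNormalizer

namespace GerbeNormalizer

variable {C : Type u} [Category.{v} C] {J : GrothendieckTopology C}

/-! ### Categories fibered in groupoids -/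

section FiberedInGroupoids

variable {X : BasedCategory.{v₁, u₁} C} {Y : BasedCategory.{v₂, u₂} C}

/-! The normalizer is built as a gerbe of pairs `(y, A)`: `y` is an object of `H`, and `A` is a
subsheaf of its automorphism sheaf that locally is a restriction of the automorphism sheaf of an
object of `G`. Arrows are the arrows of `H` that pull the second subsheaf back to the first. An
automorphism of `y` preserves `A` in this sense exactly when it normalizes `A`
(`AutSub.mem_normalizer_iff`), so the automorphism sheaf of a pair is the normalizer of `A`
(`AutSub.image_eq_normalizer`). Pairs form a stack because arrows of `H` and subsheaves both glue
(`AutSub.exists_isSheaf_restrict_eq`), and a gerbe because each pair comes locally from `G`.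

For uniqueness, every normalizer `N` is compared with the gerbe of pairs. An object `x` of `N` comes
locally from `G`, and the automorphism sheaves of these local models glue to a subsheaf on `Ψ x`.
They agree on overlaps because an arrow of `N` between objects coming from `G` is locally an arrow
of `G` composed with an automorphism in `N`, which normalizes by property (2). Conversely, an arrow
of `H` compatible with these subsheaves is locally an arrow of `N` composed with a normalizing
automorphism; the latter lies in `N` by (2), and faithfulness lets the local lifts glue
(`IsNormalizer.exists_family`). Thus `N` maps fully faithfully to the gerbe of pairs, and
essentially surjectively because it does so locally (`exists_iso_obj_of_locally`). Two normalizers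
are then related by lifting functors and 2-isomorphisms along these comparisons.

For a morphism locally equivalent to `F`, automorphism sheaves are locally those of `F`
(`LocallyEquivalent.locallyImage`), so it too factors through the pairs, hence through any
normalizer of `F`. -/

theorem map_eq_map_of_isHomLift {R S : C} (f : R ⟶ S) {c x : X.obj} (k k' : c ⟶ x)
    [X.p.IsHomLift f k] [X.p.IsHomLift f k'] : X.p.map k = X.p.map k' := by
  rw [IsHomLift.fac' X.p f k, IsHomLift.fac' X.p f k']

theorem isHomLift_of_map_eq {R S : C} (f : R ⟶ S) {c x : X.obj} (k k' : c ⟶ x)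
    [X.p.IsHomLift f k] (h : X.p.map k = X.p.map k') : X.p.IsHomLift f k' := by
  subst_hom_lift X.p f k
  rw [h]
  infer_instance

/-- The arrow `f` and the projection of `χ` differ only by an `eqToHom` on the source, which the
sieve absorbs. -/
theorem sieve_map_of_isHomLift {x : X.obj} {R : Sieve (X.p.obj x)} {T : C} (f : T ⟶ X.p.obj x)
    (hf : R f) {c : X.obj} (χ : c ⟶ x) [X.p.IsHomLift f χ] : R (X.p.map χ) := by
  have h := R.downward_closed hf (eqToHom (IsHomLift.domain_eq X.p f χ))
  rw [IsHomLift.fac' X.p f χ]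
  simpa using h

theorem map_eq_id_of_mem {x : X.obj} (a : VAut X x) : X.p.map a.1.hom = 𝟙 (X.p.obj x) := by
  have : X.p.IsHomLift (𝟙 (X.p.obj x)) a.1.hom := a.2
  exact (IsHomLift.eq_of_isHomLift X.p (𝟙 (X.p.obj x)) a.1.hom).symm

/-- A functor which sends every arrow to an arrow over the same arrow of the base is a functor over
the base. -/
def basedFunctorOfIsHomLift (F : X.obj ⥤ Y.obj)
    (h : ∀ ⦃a b : X.obj⦄ (φ : a ⟶ b), Y.p.IsHomLift (X.p.map φ) (F.map φ)) : BasedFunctor X Y where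
  toFunctor := F
  w := CategoryTheory.Functor.ext
    (fun a => by
      have := h (𝟙 a)
      exact IsHomLift.domain_eq Y.p (X.p.map (𝟙 a)) (F.map (𝟙 a)))
    (fun a b φ => by
      have := h φ
      exact IsHomLift.fac' Y.p (X.p.map φ) (F.map φ))

variable [IsFiberedInGroupoids X] [IsFiberedInGroupoids Y]

theorem isStronglyCartesian_of_isHomLift {R S : C} (f : R ⟶ S) {c x : X.obj} (l : c ⟶ x)
    [X.p.IsHomLift f l] : X.p.IsStronglyCartesian f l := by
  subst_hom_lift X.p f l
  exact isStronglyCartesian X l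

theorem exists_isHomLift {S T : C} (f : T ⟶ S) {x : X.obj} (hx : X.p.obj x = S) :
    ∃ (c : X.obj) (φ : c ⟶ x), X.p.IsHomLift f φ := by
  have := IsFiberedInGroupoids.isFibered (X := X)
  obtain ⟨c, φ, h⟩ := IsPreFibered.exists_isCartesian X.p hx f
  exact ⟨c, φ, inferInstance⟩

theorem exists_factor {R' R S : C} (g : R' ⟶ R) (f : R ⟶ S) {c d x : X.obj} (l : c ⟶ x)
    (m : d ⟶ x) [X.p.IsHomLift f l] [X.p.IsHomLift (g ≫ f) m] :
    ∃ k : d ⟶ c, X.p.IsHomLift g k ∧ k ≫ l = m := by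
  have := isStronglyCartesian_of_isHomLift f l
  exact (Functor.IsStronglyCartesian.universal_property X.p f l g (g ≫ f) rfl m).exists

theorem isIso_of_isHomLift_id {S : C} {c x : X.obj} (l : c ⟶ x) [X.p.IsHomLift (𝟙 S) l] :
    IsIso l := by
  have := isStronglyCartesian_of_isHomLift (𝟙 S) l
  exact Functor.IsStronglyCartesian.isIso_of_base_isIso X.p (𝟙 S) l

theorem exists_iso_factor {R S : C} (f : R ⟶ S) {c d x : X.obj} (l : c ⟶ x)
    (m : d ⟶ x) [X.p.IsHomLift f l] [X.p.IsHomLift f m] :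
    ∃ k : d ≅ c, X.p.IsHomLift (𝟙 R) k.hom ∧ k.hom ≫ l = m := by
  obtain ⟨k, hk, h⟩ := exists_factor (𝟙 R) f l m
  have := isIso_of_isHomLift_id (S := R) k
  exact ⟨asIso k, hk, h⟩

theorem hom_ext_of_comp {R S : C} (g : R ⟶ S) {c d x : X.obj} (l : c ⟶ x) {k k' : d ⟶ c}
    [X.p.IsHomLift g k] [X.p.IsHomLift g k'] (h : k ≫ l = k' ≫ l) : k = k' := by
  have := isStronglyCartesian X l
  have h1 : X.p.IsHomLift (X.p.map k) k' := by
    rw [map_eq_map_of_isHomLift g k k']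
    infer_instance
  exact Functor.IsStronglyCartesian.ext X.p (X.p.map l) l (X.p.map k) h

theorem exists_mem_vAut {S : C} {x : X.obj} (l : x ⟶ x) [X.p.IsHomLift (𝟙 S) l] :
    ∃ a : VAut X x, a.1.hom = l := by
  obtain rfl := IsHomLift.domain_eq X.p (𝟙 S) l
  have := isIso_of_isHomLift_id (S := X.p.obj x) l
  exact ⟨⟨asIso l, ‹X.p.IsHomLift (𝟙 (X.p.obj x)) l›⟩, rfl⟩

/-- Every arrow to the image of `x` is, up to a vertical isomorphism, the image of an arrow. -/
theorem exists_iso_map (F : BasedFunctor X Y) {c : Y.obj} {x : X.obj} (χ : c ⟶ F.obj x) :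
    ∃ (d : X.obj) (φ : d ⟶ x) (ι : c ≅ F.obj d), Y.p.IsHomLift (𝟙 (Y.p.obj c)) ι.hom ∧
      ι.hom ≫ F.map φ = χ := by
  obtain ⟨d, φ, hφ⟩ := exists_isHomLift (X := X) (Y.p.map χ ≫ eqToHom (F.w_obj x)) rfl
  obtain ⟨ι, hι, h⟩ := exists_iso_factor (X := Y) (Y.p.map χ ≫ eqToHom (F.w_obj x)) (F.map φ) χ
  exact ⟨d, φ, ι, hι, h⟩

/-- Arrows over a fixed arrow can be lifted along a functor over the base. -/
theorem exists_map_eq (F : BasedFunctor X Y) {d d' s : X.obj} (φ : d ⟶ s) (φ' : d' ⟶ s)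
    (h : F.obj d ⟶ F.obj d') (hh : h ≫ F.map φ' = F.map φ) :
    ∃ k : d ⟶ d', k ≫ φ' = φ ∧ F.map k = h := by
  let g : X.p.obj d ⟶ X.p.obj d' :=
    eqToHom (F.w_obj d).symm ≫ Y.p.map h ≫ eqToHom (F.w_obj d')
  have hg : Y.p.IsHomLift g h := inferInstance
  have h1 : X.p.IsHomLift (g ≫ X.p.map φ') φ := by
    rw [← F.isHomLift_iff, ← hh]
    infer_instance
  obtain ⟨k, hk, hkφ⟩ := exists_factor g (X.p.map φ') φ' φ
  refine ⟨k, hkφ, hom_ext_of_comp g (F.map φ') ?_⟩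
  rw [hh, ← hkφ, F.map_comp]

end FiberedInGroupoids

/-! ### Local properties of pullbacks -/

/-- A property of the pullbacks of `x` holds locally if it holds for all pullbacks along the arrows
of some covering sieve. -/
def Locally (J : GrothendieckTopology C) {X : BasedCategory.{v₁, u₁} C} (x : X.obj)
    (P : ∀ c : X.obj, (c ⟶ x) → Prop) : Prop :=
  ∃ R ∈ J (X.p.obj x), ∀ (c : X.obj) (χ : c ⟶ x), R (X.p.map χ) → P c χ

namespace Locally

variable {X : BasedCategory.{v₁, u₁} C} {Y : BasedCategory.{v₂, u₂} C} {x : X.obj}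
  {P Q : ∀ c : X.obj, (c ⟶ x) → Prop}

theorem of_sieve {S : C} (hx : X.p.obj x = S) {R : Sieve S} (hR : R ∈ J S)
    (h : ∀ ⦃T : C⦄ (f : T ⟶ S), R f → ∀ (c : X.obj) (χ : c ⟶ x), X.p.IsHomLift f χ → P c χ) :
    Locally J x P := by
  subst hx
  exact ⟨R, hR, fun c χ hχ => h _ hχ c χ inferInstance⟩

theorem exists_sieve {S : C} (hx : X.p.obj x = S) (h : Locally J x P) :
    ∃ R ∈ J S, ∀ ⦃T : C⦄ (f : T ⟶ S), R f →
      ∀ (c : X.obj) (χ : c ⟶ x), X.p.IsHomLift f χ → P c χ := by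
  subst hx
  obtain ⟨R, hR, h⟩ := h
  refine ⟨R, hR, fun T f hf c χ hχ => h c χ (sieve_map_of_isHomLift f hf χ)⟩

theorem mono (h : Locally J x P) (hPQ : ∀ (c : X.obj) (χ : c ⟶ x), P c χ → Q c χ) :
    Locally J x Q := by
  obtain ⟨R, hR, h⟩ := h
  exact ⟨R, hR, fun c χ hχ => hPQ c χ (h c χ hχ)⟩

theorem of_forall (h : ∀ (c : X.obj) (χ : c ⟶ x), P c χ) : Locally J x P :=
  ⟨⊤, J.top_mem _, fun c χ _ => h c χ⟩

theorem and (hP : Locally J x P) (hQ : Locally J x Q) :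
    Locally J x (fun c χ => P c χ ∧ Q c χ) := by
  obtain ⟨R, hR, h⟩ := hP
  obtain ⟨R', hR', h'⟩ := hQ
  exact ⟨R ⊓ R', J.intersection_covering hR hR', fun c χ hχ => ⟨h c χ hχ.1, h' c χ hχ.2⟩⟩

theorem pullback (h : Locally J x P) {c : X.obj} (χ : c ⟶ x) :
    Locally J c (fun d l => P d (l ≫ χ)) := by
  obtain ⟨R, hR, h⟩ := h
  refine ⟨R.pullback (X.p.map χ), J.pullback_stable _ hR, fun d l hl => h d _ ?_⟩
  rw [X.p.map_comp]
  exact hl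

/-- This is the transitivity axiom of the topology. An arrow over a composite in `R₀` factors
through the intermediate pullback because all arrows are cartesian. -/
theorem trans [IsFiberedInGroupoids X] (h : Locally J x P)
    (hPQ : ∀ (c : X.obj) (χ : c ⟶ x), P c χ → Locally J c (fun d l => Q d (l ≫ χ))) :
    Locally J x Q := by
  obtain ⟨R, hR, h⟩ := h
  choose R' hR' h' using fun c χ (hχ : R (X.p.map χ)) => hPQ c χ (h c χ hχ)
  let R₀ : Sieve (X.p.obj x) :=
    { arrows := fun T f => ∃ (c : X.obj) (χ : c ⟶ x) (hχ : R (X.p.map χ)) (g : T ⟶ X.p.obj c),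
        R' c χ hχ g ∧ g ≫ X.p.map χ = f
      downward_closed := by
        rintro T T' f ⟨c, χ, hχ, g, hg, rfl⟩ k
        exact ⟨c, χ, hχ, k ≫ g, (R' c χ hχ).downward_closed hg k, by simp⟩ }
  refine ⟨R₀, J.transitive hR _ fun T f hf => ?_, ?_⟩
  · obtain ⟨c, χ, hχ⟩ := exists_isHomLift (X := X) f rfl
    obtain rfl := IsHomLift.domain_eq X.p f χ
    obtain rfl := IsHomLift.eq_of_isHomLift X.p f χ
    exact J.superset_covering (fun T' g hg => ⟨c, χ, hf, g, hg, rfl⟩) (hR' c χ hf)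
  · rintro d ψ ⟨c, χ, hχ, g, hg, hgψ⟩
    have : X.p.IsHomLift (g ≫ X.p.map χ) ψ := by
      rw [hgψ]
      infer_instance
    obtain ⟨l, hl, rfl⟩ := exists_factor g (X.p.map χ) χ ψ
    refine h' c χ hχ d l ?_
    rwa [← IsHomLift.eq_of_isHomLift X.p g l]

/-- Pullbacks of `F.obj x` are, up to isomorphism, images of pullbacks of `x`, so a covering sieve
for `x` also serves for its image. -/
theorem map [IsFiberedInGroupoids X] [IsFiberedInGroupoids Y] (h : Locally J x P)
    (F : BasedFunctor X Y) :
    Locally J (F.obj x) (fun d χ => ∃ (c : X.obj) (φ : c ⟶ x) (ι : d ≅ F.obj c),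
      ι.hom ≫ F.map φ = χ ∧ P c φ) := by
  obtain ⟨R, hR, h⟩ := h
  refine of_sieve (F.w_obj x) hR fun T f hf d χ hχ => ?_
  obtain ⟨c, φ, hφ⟩ := exists_isHomLift (X := X) f rfl
  obtain ⟨ι, -, hι⟩ := exists_iso_factor f (F.map φ) χ
  exact ⟨c, φ, ι, hι, h c φ (sieve_map_of_isHomLift f hf φ)⟩

theorem comap (F : BasedFunctor X Y) {P : ∀ c : Y.obj, (c ⟶ F.obj x) → Prop}
    (h : Locally J (F.obj x) P) : Locally J x (fun c φ => P (F.obj c) (F.map φ)) := by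
  obtain ⟨R, hR, h⟩ := h.exists_sieve (F.w_obj x)
  exact ⟨R, hR, fun c φ hφ => h (X.p.map φ) hφ _ _ inferInstance⟩

end Locally

/-! ### Gluing morphisms -/

section Gluing

variable {X : BasedCategory.{v₁, u₁} C} {Y : BasedCategory.{v₂, u₂} C}

/-- The local arrows are specified by a property that determines them uniquely. Together with
stability of the property under restriction, uniqueness makes them a compatible family. -/
theorem exists_glue [IsStackInGroupoids J X] {S : C} {x y : X.obj} (hx : X.p.obj x = S)
    (hy : X.p.obj y = S) {R : Sieve S} (hR : R ∈ J S)
    (P : ∀ (c : X.obj), (c ⟶ x) → (c ⟶ y) → Prop)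
    (hP : ∀ ⦃T : C⦄ (f : T ⟶ S), R f → ∀ (c : X.obj) (φ : c ⟶ x), X.p.IsHomLift f φ →
      ∃! m : c ⟶ y, X.p.IsHomLift f m ∧ P c φ m)
    (hcomp : ∀ (c d : X.obj) (l : d ⟶ c) (φ : c ⟶ x) (m : c ⟶ y), P c φ m →
      P d (l ≫ φ) (l ≫ m)) :
    ∃ μ : x ⟶ y, X.p.IsHomLift (𝟙 S) μ ∧ ∀ ⦃T : C⦄ (f : T ⟶ S), R f →
      ∀ (c : X.obj) (φ : c ⟶ x), X.p.IsHomLift f φ → P c φ (φ ≫ μ) := by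
  subst hx
  choose m hm hm' using fun c φ (h : R (X.p.map φ)) => hP (X.p.map φ) h c φ inferInstance
  obtain ⟨μ, ⟨hμ, h⟩, -⟩ := IsStackInGroupoids.existsUnique_glue (J := J) x y hy R hR
    (fun c φ h => m c φ h) (fun c φ h => (hm c φ h).1) (fun c d φ l h h' => by
      refine (hm' _ _ h' _ ⟨?_, hcomp _ _ _ _ _ (hm c φ h).2⟩).symm
      have := (hm c φ h).1
      rw [X.p.map_comp]
      infer_instance)
  refine ⟨μ, hμ, fun T f hf c φ hφ => ?_⟩
  have hf' := sieve_map_of_isHomLift f hf φ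
  rw [h φ hf']
  exact (hm c φ hf').2

/-- The gluing axiom concerns vertical arrows only. Both arrows are therefore factored through one
pullback of `y`, and their vertical parts are compared. -/
theorem hom_ext_of_locally [IsStackInGroupoids J X] {x y : X.obj} (g h : x ⟶ y)
    (hgh : X.p.map g = X.p.map h) (H : Locally J x (fun _ χ => χ ≫ g = χ ≫ h)) : g = h := by
  have : IsFiberedInGroupoids X := IsStackInGroupoids.toIsFiberedInGroupoids J
  obtain ⟨z, π, hπ⟩ := exists_isHomLift (X := X) (X.p.map g) (x := y) rfl
  have hz : X.p.obj z = X.p.obj x := IsHomLift.domain_eq X.p (X.p.map g) π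
  have h1 : X.p.IsHomLift (X.p.map g) h := by rw [hgh]; infer_instance
  obtain ⟨g', hg', e⟩ := exists_iso_factor (X.p.map g) π g
  obtain ⟨h', hh', e'⟩ := exists_iso_factor (X.p.map g) π h
  obtain ⟨R, hR, H⟩ := H
  have := IsStackInGroupoids.existsUnique_glue (J := J) x z hz R hR
    (fun c φ _ => φ ≫ g'.hom) (fun c φ _ => inferInstance) (fun c d φ l _ _ => by simp)
  rw [← e, ← e', this.unique (y₁ := g'.hom) (y₂ := h'.hom) ⟨hg', fun _ _ _ => rfl⟩ ⟨hh', ?_⟩]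
  intro c φ hφ
  refine hom_ext_of_comp (X.p.map φ) π ?_
  rw [Category.assoc, Category.assoc, e, e', H c φ hφ]

/-- An arrow which lifts locally along a faithful functor to a stack lifts. -/
theorem exists_map_eq_of_locally [IsStackInGroupoids J X] [IsStackInGroupoids J Y]
    (F : BasedFunctor X Y) (hF : F.toFunctor.Faithful) {x y : X.obj} (h : F.obj x ⟶ F.obj y)
    (H : Locally J x (fun c φ => ∃ m : c ⟶ y, F.map m = F.map φ ≫ h)) :
    ∃ μ : x ⟶ y, F.map μ = h := by
  have : IsFiberedInGroupoids X := IsStackInGroupoids.toIsFiberedInGroupoids J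
  have : IsFiberedInGroupoids Y := IsStackInGroupoids.toIsFiberedInGroupoids J
  let f : X.p.obj x ⟶ X.p.obj y := eqToHom (F.w_obj x).symm ≫ Y.p.map h ≫ eqToHom (F.w_obj y)
  have hf : Y.p.IsHomLift f h := inferInstance
  -- Since `h` need not be vertical, the lift is glued as a vertical arrow into the pullback `z` of
  -- `y`; faithfulness makes the local lifts unique.
  obtain ⟨z, π, hπ⟩ := exists_isHomLift (X := X) f (x := y) rfl
  have hz : X.p.obj z = X.p.obj x := IsHomLift.domain_eq X.p f π
  obtain ⟨R, hR, H⟩ := H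
  obtain ⟨μ, hμ, hμ'⟩ := exists_glue (J := J) (x := x) (y := z) rfl hz hR
    (fun c φ m => F.map (m ≫ π) = F.map φ ≫ h) (fun T g hg c φ hφ => by
      obtain ⟨m, hm⟩ := H c φ (sieve_map_of_isHomLift g hg φ)
      have h1 : X.p.IsHomLift (g ≫ f) m := by
        rw [← F.isHomLift_iff, hm]
        infer_instance
      obtain ⟨k, hk, rfl⟩ := exists_factor g f π m
      refine ⟨k, ⟨hk, hm⟩, fun k' ⟨hk', h'⟩ => ?_⟩
      exact hom_ext_of_comp g π (hF.map_injective (h'.trans hm.symm)))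
    (fun c d l φ m hm => by
      rw [Category.assoc, F.map_comp, hm, F.map_comp, Category.assoc])
  refine ⟨μ ≫ π, ?_⟩
  have hμf : Y.p.IsHomLift f (F.map (μ ≫ π)) := inferInstance
  refine hom_ext_of_locally (J := J) _ _ (map_eq_map_of_isHomLift f _ _) ?_
  have h1 : Locally J x (fun c φ => F.map φ ≫ F.map (μ ≫ π) = F.map φ ≫ h) :=
    ⟨R, hR, fun c φ hφ => by
      change F.map φ ≫ F.map (μ ≫ π) = F.map φ ≫ h
      rw [← F.map_comp, ← Category.assoc]
      exact hμ' _ hφ c φ inferInstance⟩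
  refine (h1.map F).mono ?_
  rintro d _ ⟨c, φ, ι, rfl, e⟩
  rw [Category.assoc, e, Category.assoc]

end Gluing

/-! ### Restriction of subsheaves and the normalizer condition. -/

namespace AutSub

variable {X : BasedCategory.{v₁, u₁} C} {Y : BasedCategory.{v₂, u₂} C}

theorem restrict_restrict {x : X.obj} (A : AutSub X x) {c d : X.obj} (χ : c ⟶ x) (l : d ⟶ c) :
    (A.restrict χ).restrict l = A.restrict (l ≫ χ) := by
  ext e k a
  simp [restrict]

theorem restrict_id {x : X.obj} (A : AutSub X x) : A.restrict (𝟙 x) = A := by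
  ext e k a
  simp [restrict]

theorem sections_eq_of_restrict_eq {x y : X.obj} {A : AutSub X x} {B : AutSub X y} {c : X.obj}
    {χ : c ⟶ x} {ψ : c ⟶ y} (h : A.restrict χ = B.restrict ψ) : A.sections χ = B.sections ψ := by
  have h1 : (A.restrict χ).sections (𝟙 c) = (B.restrict ψ).sections (𝟙 c) := by rw [h]
  simpa [restrict] using h1

theorem restrict_eq_of_comp_eq {x y : X.obj} {A : AutSub X x} {B : AutSub X y} {c d : X.obj}
    {χ : c ⟶ x} {ψ : c ⟶ y} (ι : d ≅ c) (h : A.restrict (ι.hom ≫ χ) = B.restrict (ι.hom ≫ ψ)) :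
    A.restrict χ = B.restrict ψ := by
  have h1 : (A.restrict (ι.hom ≫ χ)).restrict ι.inv = (B.restrict (ι.hom ≫ ψ)).restrict ι.inv := by
    rw [h]
  simpa [restrict_restrict] using h1

theorem mem_iff_of_iso {x : X.obj} (A : AutSub X x) {c d : X.obj} (χ : c ⟶ x) (ι : d ≅ c)
    {a : VAut X c} {b : VAut X d} (h : IsRestriction ι.hom b a) :
    b ∈ A.sections (ι.hom ≫ χ) ↔ a ∈ A.sections χ := by
  refine ⟨fun hb => ?_, A.restr_mem χ ι.hom a b h⟩
  have h1 := A.restr_mem (ι.hom ≫ χ) ι.inv b a (by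
    simp only [IsRestriction] at *
    rw [Iso.eq_inv_comp, ← Category.assoc, ← h, Category.assoc, Iso.hom_inv_id, Category.comp_id]) hb
  simpa using h1

/-- A restriction `m` of `n` along `l` satisfies `m ≫ l = l ≫ n`, and pulling sections back along
the automorphism `m` is conjugation. Normalizing `A` thus becomes invariance under pullback along
`n`, which is the condition defining arrows of pairs. -/
theorem mem_normalizer_iff [IsFiberedInGroupoids X] {x : X.obj} (A : AutSub X x) {c : X.obj}
    (χ : c ⟶ x) (n : VAut X c) :
    n ∈ A.normalizer.sections χ ↔ (A.restrict χ).restrict n.1.hom = A.restrict χ := by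
  have key : ∀ (d : X.obj) (l : d ⟶ c) (m : VAut X d), IsRestriction l m n → ∀ a : VAut X d,
      a ∈ A.sections ((l ≫ n.1.hom) ≫ χ) ↔ m * a * m⁻¹ ∈ A.sections (l ≫ χ) := by
    intro d l m hm a
    rw [← hm, Category.assoc]
    refine A.mem_iff_of_iso (l ≫ χ) m.1 ?_
    change a.1.hom ≫ m.1.hom = m.1.hom ≫ m.1.inv ≫ a.1.hom ≫ m.1.hom
    exact (Iso.hom_inv_id_assoc (m.1 : d ≅ d) _).symm
  constructor
  · intro hn
    ext d l a
    obtain ⟨m, hm⟩ := (existsUnique_isRestriction X l n).exists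
    exact (key d l m hm a).trans (hn l m hm a).symm
  · intro h d l m hm a
    rw [← key d l m hm a]
    have h1 : ((A.restrict χ).restrict n.1.hom).sections l = (A.restrict χ).sections l := by rw [h]
    exact (Set.ext_iff.1 h1 a).symm

/-! ### Subsheaves -/

/-- A sub-presheaf of the automorphism sheaf is a sheaf if an automorphism belongs to it as soon as
it does so locally. -/
def IsSheaf (J : GrothendieckTopology C) {x : X.obj} (A : AutSub X x) : Prop :=
  ∀ (c : X.obj) (χ : c ⟶ x) (a : VAut X c),
    Locally J c (fun d l => ∀ b : VAut X d, IsRestriction l b a → b ∈ A.sections (l ≫ χ)) →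
    a ∈ A.sections χ

theorem IsSheaf.restrict {x : X.obj} {A : AutSub X x} (hA : A.IsSheaf J) {c : X.obj} (χ : c ⟶ x) :
    (A.restrict χ).IsSheaf J := fun d l a h =>
  hA d (l ≫ χ) a (h.mono fun e k h b hb => by
    have := h b hb
    simpa [AutSub.restrict] using this)

theorem sections_subset_of_locally {x : X.obj} {A B : AutSub X x} (hB : B.IsSheaf J)
    (h : Locally J x (fun _ χ => A.restrict χ = B.restrict χ)) {c : X.obj} (χ : c ⟶ x) :
    A.sections χ ⊆ B.sections χ := fun a ha =>
  hB c χ a ((h.pullback χ).mono fun d l h b hb => by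
    rw [← sections_eq_of_restrict_eq h]
    exact A.restr_mem χ l a b hb ha)

theorem IsSheaf.ext_of_locally {x : X.obj} {A B : AutSub X x} (hA : A.IsSheaf J)
    (hB : B.IsSheaf J) (h : Locally J x (fun _ χ => A.restrict χ = B.restrict χ)) : A = B := by
  ext c χ a
  exact ⟨fun ha => sections_subset_of_locally hB h χ ha,
    fun ha => sections_subset_of_locally hA (h.mono fun _ _ h => h.symm) χ ha⟩

/-- Compatible subsheaves on objects over `y` extend to a subsheaf on `y`. -/
theorem exists_isSheaf_restrict_eq [IsFiberedInGroupoids Y] {y : Y.obj} {I : Type*} {z : I → Y.obj}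
    (π : ∀ i, z i ⟶ y) (A : ∀ i, AutSub Y (z i)) (hA : ∀ i, (A i).IsSheaf J)
    (h : ∀ (i j : I) (d : Y.obj) (k : d ⟶ z i) (k' : d ⟶ z j), k ≫ π i = k' ≫ π j →
      (A i).restrict k = (A j).restrict k') :
    ∃ B : AutSub Y y, B.IsSheaf J ∧ ∀ i, B.restrict (π i) = A i := by
  -- The largest possible extension: a section is accepted when all its restrictions that factor
  -- over some `z i` lie in `A i`. The `π i` need not cover `y`.
  let B : AutSub Y y :=
    { sections := fun c χ => {a | ∀ (i : I) (d : Y.obj) (l : d ⟶ c) (k : d ⟶ z i),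
        l ≫ χ = k ≫ π i → ∀ b : VAut Y d, IsRestriction l b a → b ∈ (A i).sections k}
      restr_mem := by
        intro c d χ l a b hab ha i e l' k hk b' hb'
        refine ha i e (l' ≫ l) k (by simpa using hk) b' ?_
        simp only [IsRestriction] at *
        rw [reassoc_of% hb', hab, Category.assoc] }
  refine ⟨B, ?_, ?_⟩
  · intro c χ a ha i d l k hk b hb
    refine hA i d k b ((ha.pullback l).mono fun e l' h' b' hb' => ?_)
    refine h' b' ?_ i e (𝟙 e) (l' ≫ k) (by simp [hk]) b' (by simp [IsRestriction])
    simp only [IsRestriction] at *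
    rw [reassoc_of% hb', hb, Category.assoc]
  · intro i
    ext c κ a
    constructor
    · intro ha
      exact ha i c (𝟙 c) κ (by simp) a (by simp [IsRestriction])
    · intro ha j d l k hk b hb
      rw [← sections_eq_of_restrict_eq (h i j d (l ≫ κ) k (by simpa using hk))]
      exact (A i).restr_mem κ l a b hb ha

/-! ### Images of automorphism sheaves -/

section Image

/-- Membership in the image allows any factorization, but one fixed factorization suffices: it maps
to every other one by cartesianness, and the automorphism restricts along that map. -/
theorem mem_image_iff [IsFiberedInGroupoids X] [IsFiberedInGroupoids Y] (F : BasedFunctor X Y)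
    {s d : X.obj} {c : Y.obj} (φ : d ⟶ s) (ι : c ≅ F.obj d) (b : VAut Y c) :
    b ∈ (image F s).sections (ι.hom ≫ F.map φ) ↔
      ∃ a : VAut X d, IsRestriction ι.hom b (mapVAut F d a) := by
  constructor
  · rintro ⟨d', φ', ι', a', h, h'⟩
    obtain ⟨k, hk, hk'⟩ := exists_map_eq F φ φ' (ι.inv ≫ ι') (by simp [h])
    obtain ⟨a, ha⟩ := (existsUnique_isRestriction X k a').exists
    refine ⟨a, ?_⟩
    have e1 : ι.hom ≫ F.map k = ι' := by simp [hk']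
    have e2 : F.map a.1.hom ≫ F.map k = F.map k ≫ F.map a'.1.hom := by
      rw [← F.map_comp, ha, F.map_comp]
    have e3 : b.1.hom ≫ ι' = ι' ≫ F.map a'.1.hom := h'
    have hb : Y.p.map b.1.hom = 𝟙 _ := map_eq_id_of_mem b
    have ha : Y.p.map (F.map a.1.hom) = 𝟙 _ := map_eq_id_of_mem (mapVAut F d a)
    have : Y.p.IsHomLift (Y.p.map ι.hom) (ι.hom ≫ F.map a.1.hom) :=
      isHomLift_of_map_eq (Y.p.map ι.hom) ι.hom _ (by rw [Y.p.map_comp, ha, Category.comp_id])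
    have : Y.p.IsHomLift (Y.p.map ι.hom) (b.1.hom ≫ ι.hom) :=
      isHomLift_of_map_eq (Y.p.map ι.hom) ι.hom _ (by rw [Y.p.map_comp, hb, Category.id_comp])
    change b.1.hom ≫ ι.hom = ι.hom ≫ F.map a.1.hom
    refine hom_ext_of_comp (Y.p.map ι.hom) (F.map k) ?_
    rw [Category.assoc, Category.assoc, e1, e2, reassoc_of% e1, e3]
  · rintro ⟨a, ha⟩
    exact ⟨d, φ, ι.hom, a, rfl, ha⟩

theorem image_eq_restrict [IsFiberedInGroupoids X] [IsFiberedInGroupoids Y] (F : BasedFunctor X Y)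
    {s s' : X.obj} (l : s ⟶ s') : image F s = (image F s').restrict (F.map l) := by
  ext c χ b
  obtain ⟨d, φ, ι, -, rfl⟩ := exists_iso_map F χ
  change _ ↔ b ∈ (image F s').sections ((ι.hom ≫ F.map φ) ≫ F.map l)
  rw [Category.assoc, ← F.map_comp, mem_image_iff, mem_image_iff]

theorem image_eq_restrict_app [IsFiberedInGroupoids X] [IsFiberedInGroupoids Y]
    {F F' : BasedFunctor X Y} (θ : F ≅ F') (s : X.obj) :
    image F s = (image F' s).restrict (θ.hom.toNatTrans.app s) := by
  ext c χ b
  obtain ⟨d, φ, ι, -, rfl⟩ := exists_iso_map F χ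
  let j : F.obj d ≅ F'.obj d := ((BasedNatTrans.forgetful X Y).mapIso θ).app d
  have hj : θ.hom.toNatTrans.app d = j.hom := rfl
  have hn : ∀ {e e' : X.obj} (l : e ⟶ e'), F.map l ≫ θ.hom.toNatTrans.app e' =
    θ.hom.toNatTrans.app e ≫ F'.map l := fun l => θ.hom.toNatTrans.naturality l
  change _ ↔ b ∈ (image F' s).sections ((ι.hom ≫ F.map φ) ≫ θ.hom.toNatTrans.app s)
  have e : (ι.hom ≫ F.map φ) ≫ θ.hom.toNatTrans.app s = (ι ≪≫ j).hom ≫ F'.map φ := by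
    rw [Category.assoc, hn, Iso.trans_hom, Category.assoc, hj]
  rw [e, mem_image_iff, mem_image_iff]
  refine exists_congr fun a => ?_
  change b.1.hom ≫ ι.hom = ι.hom ≫ F.map a.1.hom ↔
    b.1.hom ≫ ι.hom ≫ θ.hom.toNatTrans.app d =
      (ι.hom ≫ θ.hom.toNatTrans.app d) ≫ F'.map a.1.hom
  rw [Category.assoc, ← hn, ← Category.assoc, ← Category.assoc, hj, cancel_mono]

/-- Transported to `F.obj d`, the section becomes an endomorphism that lifts locally; faithfulness
makes the lifts glue. -/
theorem isSheaf_image [IsStackInGroupoids J X] [IsStackInGroupoids J Y] (F : BasedFunctor X Y)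
    (hF : F.toFunctor.Faithful) (s : X.obj) : (image F s).IsSheaf J := by
  have : IsFiberedInGroupoids X := IsStackInGroupoids.toIsFiberedInGroupoids J
  have : IsFiberedInGroupoids Y := IsStackInGroupoids.toIsFiberedInGroupoids J
  intro c χ b H
  obtain ⟨d, φ, ι, -, rfl⟩ := exists_iso_map F χ
  rw [mem_image_iff]
  obtain ⟨μ, hμ⟩ := exists_map_eq_of_locally (J := J) F hF (ι.inv ≫ b.1.hom ≫ ι.hom) (by
    refine ((H.pullback ι.inv).comap F).mono fun e ψ h => ?_
    obtain ⟨b', hb'⟩ := (existsUnique_isRestriction Y (F.map ψ ≫ ι.inv) b).exists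
    have h1 := h b' hb'
    have h2 : (F.map ψ ≫ ι.inv) ≫ ι.hom ≫ F.map φ = (Iso.refl _).hom ≫ F.map (ψ ≫ φ) := by simp
    rw [h2, mem_image_iff] at h1
    obtain ⟨a, ha⟩ := h1
    have h3 : b'.1.hom = F.map a.1.hom :=
      (Category.comp_id _).symm.trans (Eq.trans ha (Category.id_comp _))
    refine ⟨a.1.hom ≫ ψ, ?_⟩
    have h4 : b'.1.hom ≫ F.map ψ ≫ ι.inv = (F.map ψ ≫ ι.inv) ≫ b.1.hom := hb'
    rw [F.map_comp, ← h3, ← cancel_mono ι.inv]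
    simpa using h4)
  have hμ' : X.p.IsHomLift (𝟙 (X.p.obj d)) μ := by
    rw [← F.isHomLift_iff, hμ]
    refine IsHomLift.of_fac' Y.p _ _ (F.w_obj d) (F.w_obj d) ?_
    rw [Y.p.map_comp, Y.p.map_comp, map_eq_id_of_mem, Category.id_comp, ← Y.p.map_comp]
    simp
  obtain ⟨a, rfl⟩ := exists_mem_vAut (S := X.p.obj d) μ
  refine ⟨a, ?_⟩
  change b.1.hom ≫ ι.hom = ι.hom ≫ F.map a.1.hom
  simp [hμ]

/-- If the arrows which lift along `F` are the ones compatible with the subsheaves `A`, the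
automorphism sheaf of `x` is the normalizer of `A x`. -/
theorem image_eq_normalizer [IsFiberedInGroupoids X] [IsFiberedInGroupoids Y]
    (F : BasedFunctor X Y) (A : ∀ x, AutSub Y (F.obj x))
    (h : ∀ (x y : X.obj) (l : F.obj x ⟶ F.obj y),
      (∃ m : x ⟶ y, F.map m = l) ↔ A x = (A y).restrict l) (x : X.obj) :
    image F x = (A x).normalizer := by
  ext c χ b
  obtain ⟨d, φ, ι, -, rfl⟩ := exists_iso_map F χ
  have hd : A d = (A x).restrict (F.map φ) := (h _ _ _).1 ⟨φ, rfl⟩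
  have h1 : (∃ a : VAut X d, IsRestriction ι.hom b (mapVAut F d a)) ↔
      ∃ m : d ⟶ d, F.map m = ι.inv ≫ b.1.hom ≫ ι.hom := by
    constructor
    · rintro ⟨a, ha⟩
      refine ⟨a.1.hom, ?_⟩
      rw [Iso.eq_inv_comp]
      exact ha.symm
    · rintro ⟨m, hm⟩
      have hm' : X.p.IsHomLift (𝟙 (X.p.obj d)) m := by
        rw [← F.isHomLift_iff, hm]
        refine IsHomLift.of_fac' Y.p _ _ (F.w_obj d) (F.w_obj d) ?_
        rw [Y.p.map_comp, Y.p.map_comp, map_eq_id_of_mem, Category.id_comp, ← Y.p.map_comp]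
        simp
      obtain ⟨a, rfl⟩ := exists_mem_vAut (S := X.p.obj d) m
      refine ⟨a, ?_⟩
      change b.1.hom ≫ ι.hom = ι.hom ≫ F.map a.1.hom
      simp [hm]
  -- Lifting the transported endomorphism means that it preserves `A d`. As `A d` is the restriction
  -- of `A x`, this says that `b` preserves the restriction of `A x` to `c`.
  rw [mem_image_iff, h1, h, mem_normalizer_iff, ← restrict_restrict _ _ ι.hom, ← hd,
    restrict_restrict]
  constructor
  · intro h2
    conv_rhs => rw [h2, restrict_restrict]
    simp
  · intro h2
    refine (restrict_id _).symm.trans (restrict_eq_of_comp_eq ι ?_)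
    simpa using h2.symm

end Image

end AutSub

/-! ### Fully faithful morphisms -/

section FullyFaithful

variable {X : BasedCategory.{v₁, u₁} C} {Y : BasedCategory.{v₂, u₂} C}
  {M : BasedCategory.{v₃, u₃} C}

/-- Lifts of objects are chosen arbitrarily; full faithfulness then forces the action on arrows and
its functoriality. -/
theorem exists_comp_iso (P : BasedFunctor X M) (Q : BasedFunctor Y M) (hQ : Q.toFunctor.Full)
    (hQ' : Q.toFunctor.Faithful)
    (h : ∀ x : X.obj, ∃ (y : Y.obj) (i : Q.obj y ≅ P.obj x),
      M.p.IsHomLift (𝟙 (X.p.obj x)) i.hom) :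
    ∃ E : BasedFunctor X Y, Nonempty (BasedFunctor.comp E Q ≅ P) := by
  choose E₀ i hi using h
  let E : X.obj ⥤ Y.obj :=
    { obj := E₀
      map := fun {a b} l => Q.toFunctor.preimage ((i a).hom ≫ P.map l ≫ (i b).inv)
      map_id := fun a => Q.map_injective (by simp)
      map_comp := fun l m => Q.map_injective (by simp) }
  have hE : ∀ {a b : X.obj} (l : a ⟶ b), Q.map (E.map l) = (i a).hom ≫ P.map l ≫ (i b).inv :=
    fun l => Q.toFunctor.map_preimage _
  let E' : BasedFunctor X Y := basedFunctorOfIsHomLift E fun a b l => by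
    rw [← Q.isHomLift_iff, hE]
    have := hi a
    have := hi b
    infer_instance
  refine ⟨E', ⟨BasedNatIso.mkNatIso (NatIso.ofComponents i fun {a b} l => ?_) hi⟩⟩
  change Q.map (E.map l) ≫ (i b).hom = (i a).hom ≫ P.map l
  simp [hE]

theorem exists_whiskerRight_eq (Q : BasedFunctor Y M) (hQ : Q.toFunctor.Full)
    (hQ' : Q.toFunctor.Faithful) {E E' : BasedFunctor X Y}
    (η : BasedFunctor.comp E Q ≅ BasedFunctor.comp E' Q) :
    ∃ a : E ≅ E', BasedCategory.whiskerRight a.hom Q = η.hom := by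
  let η' : E.toFunctor ⋙ Q.toFunctor ≅ E'.toFunctor ⋙ Q.toFunctor :=
    (BasedNatTrans.forgetful X M).mapIso η
  have hη' : ∀ x, η'.hom.app x = η.hom.toNatTrans.app x := fun x => rfl
  let a : E.toFunctor ≅ E'.toFunctor := NatIso.ofComponents
    (fun x => Q.toFunctor.preimageIso (η'.app x)) (fun {x y} l => Q.map_injective (by
      simpa using η'.hom.naturality l))
  have ha : ∀ x, Q.map (a.hom.app x) = η'.hom.app x := fun x => by simp [a]
  refine ⟨BasedNatIso.mkNatIso a fun x => ?_, ?_⟩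
  · rw [← Q.isHomLift_iff, ha, hη']
    exact η.hom.isHomLift' x
  · apply BasedNatTrans.homCategory.ext
    apply NatTrans.ext
    funext x
    exact ha x

/-- A fully faithful morphism of stacks which is locally essentially surjective is essentially
surjective. -/
theorem exists_iso_obj_of_locally [IsStackInGroupoids J Y] [IsStackInGroupoids J M]
    (Q : BasedFunctor Y M) (hQ : Q.toFunctor.Full) (hQ' : Q.toFunctor.Faithful) (m : M.obj)
    (h : Locally J m (fun c _ => ∃ y : Y.obj, Nonempty (c ⟶ Q.obj y))) :
    ∃ (y : Y.obj) (i : Q.obj y ≅ m), M.p.IsHomLift (𝟙 (M.p.obj m)) i.hom := by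
  have : IsFiberedInGroupoids Y := IsStackInGroupoids.toIsFiberedInGroupoids J
  have : IsFiberedInGroupoids M := IsStackInGroupoids.toIsFiberedInGroupoids J
  obtain ⟨S, hS⟩ : ∃ S, M.p.obj m = S := ⟨_, rfl⟩
  obtain ⟨R, hR, h⟩ := h.exists_sieve hS
  have h1 : ∀ f : R.arrows.category, ∃ (y : Y.obj) (ρ : Q.obj y ⟶ m),
      M.p.IsHomLift f.obj.hom ρ := by
    intro f
    obtain ⟨c, χ, hχ⟩ := exists_isHomLift (X := M) f.obj.hom hS
    obtain ⟨y, ⟨l⟩⟩ := h f.obj.hom f.property c χ hχ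
    obtain ⟨d, φ, ι, hι, -⟩ := exists_iso_map Q l
    have hι' : M.p.IsHomLift (𝟙 f.obj.left) ι.inv := by
      have := IsHomLift.domain_eq M.p f.obj.hom χ
      rw [this] at hι
      infer_instance
    exact ⟨d, ι.inv ≫ χ, inferInstance⟩
  choose y ρ hρ using h1
  -- Fullness lifts the transition arrows between the chosen local preimages. Their uniqueness, by
  -- faithfulness, makes these preimages a descent datum.
  have h2 : ∀ (f g : R.arrows.category) (k : f ⟶ g), ∃ l : y f ⟶ y g,
      Y.p.IsHomLift k.hom.left l ∧ Q.map l ≫ ρ g = ρ f := by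
    intro f g k
    have : M.p.IsHomLift (k.hom.left ≫ g.obj.hom) (ρ f) := by
      rw [Over.w k.hom]
      exact hρ f
    obtain ⟨t, ht, hte⟩ := exists_factor k.hom.left g.obj.hom (ρ g) (ρ f)
    obtain ⟨l, rfl⟩ := Q.toFunctor.map_surjective t
    exact ⟨l, Q.isHomLift_map k.hom.left l, hte⟩
  choose D hD hDρ using h2
  have hDu : ∀ {f g : R.arrows.category} (k : f ⟶ g) (l : y f ⟶ y g),
      Y.p.IsHomLift k.hom.left l → Q.map l ≫ ρ g = ρ f → D f g k = l := by
    intro f g k l hl hlρ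
    have := hD f g k
    exact Q.map_injective (hom_ext_of_comp k.hom.left (ρ g) ((hDρ f g k).trans hlρ.symm))
  have hy : ∀ f, Y.p.obj (y f) = f.obj.left := fun f =>
    (Q.w_obj _).symm.trans (by have := hρ f; exact IsHomLift.domain_eq M.p f.obj.hom (ρ f))
  let D₀ : R.arrows.category ⥤ Y.obj :=
    { obj := y
      map := fun {f g} k => D f g k
      map_id := fun f => hDu _ _ (IsHomLift.id (hy f)) (by simp)
      map_comp := fun {f g e} k l => hDu _ _ (by
          have := hD f g k
          have := hD g e l
          change Y.p.IsHomLift (k.hom.left ≫ l.hom.left) _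
          infer_instance) (by
          rw [Q.map_comp, Category.assoc, hDρ, hDρ]) }
  let D' : BasedFunctor (sieveBased R) Y := basedFunctorOfIsHomLift D₀ fun f g k => hD f g k
  have h3 : ∃ (x : Y.obj) (π : ∀ f : R.arrows.category, y f ⟶ x), Y.p.obj x = S ∧
      (∀ f : R.arrows.category, Y.p.IsHomLift f.obj.hom (π f)) ∧
      ∀ (f g : R.arrows.category) (k : f ⟶ g), D f g k ≫ π g = π f := by
    obtain ⟨x, π, hx, hπ, hπD⟩ := IsStackInGroupoids.exists_descent (J := J) S R hR D'
    exact ⟨x, π, hx, hπ, hπD⟩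
  obtain ⟨x, π, hx, hπ, hπD⟩ := h3
  have hπ' : ∀ f, M.p.IsHomLift f.obj.hom (Q.map (π f)) := fun f => by
    have := hπ f
    infer_instance
  obtain ⟨μ, hμ, -⟩ := exists_glue (J := J) (x := Q.obj x) (y := m) ((Q.w_obj x).trans hx) hS hR
    -- The arrow from the descended object to `m` is prescribed locally: factor through some `Q.obj
    -- (y f)`, then follow `ρ f`. Any other factorization is compared with the one for the sieve
    -- arrow itself by a morphism of the sieve.
    (fun c φ t => ∃ (f : R.arrows.category) (j : c ⟶ Q.obj (y f)), j ≫ Q.map (π f) = φ ∧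
      j ≫ ρ f = t) (fun T f hf c φ hφ => by
      let o : R.arrows.category := ⟨Over.mk f, hf⟩
      have := hπ' o
      have : M.p.IsHomLift f (Q.map (π o)) := hπ' o
      have : M.p.IsHomLift f (ρ o) := hρ o
      obtain ⟨j, hj, hjφ⟩ := exists_iso_factor f (Q.map (π o)) φ
      refine ⟨j.hom ≫ ρ o, ⟨inferInstance, o, j.hom, hjφ, rfl⟩, ?_⟩
      rintro t ⟨ht, g, k, hk, rfl⟩
      let a : T ⟶ g.obj.left := eqToHom (IsHomLift.domain_eq M.p f φ).symm ≫ M.p.map k ≫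
        eqToHom ((Q.w_obj _).trans (hy g))
      have ha : M.p.IsHomLift a k := inferInstance
      have haf : a ≫ g.obj.hom = f := by
        have := hπ' g
        have h1 : M.p.IsHomLift (a ≫ g.obj.hom) φ := by
          rw [← hk]
          exact IsHomLift.comp M.p a g.obj.hom k (Q.map (π g))
        rw [IsHomLift.fac M.p f φ, IsHomLift.fac M.p (a ≫ g.obj.hom) φ]
      let α : o ⟶ g := ⟨Over.homMk a haf⟩
      have h3 : k = j.hom ≫ Q.map (D o g α) := by
        have : Y.p.IsHomLift a (D o g α) := hD o g α
        refine hom_ext_of_comp (X := M) a (Q.map (π g)) ?_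
        rw [hk, Category.assoc, ← Q.map_comp, ← hjφ]
        rw [hπD]
      rw [h3, Category.assoc, hDρ]) (fun c d l φ t ⟨f, j, hj, hj'⟩ =>
        ⟨f, l ≫ j, by rw [Category.assoc, hj], by rw [Category.assoc, hj']⟩)
  subst hS
  have := isIso_of_isHomLift_id (X := M) (S := M.p.obj m) μ
  exact ⟨x, asIso μ, hμ⟩

end FullyFaithful

/-- A cartesian arrow over an isomorphism is an isomorphism, which makes the fibers groupoids. -/
theorem isFiberedInGroupoids_of_isStronglyCartesian {X : BasedCategory.{v₁, u₁} C}
    (hlift : ∀ (x : X.obj) (T : C) (f : T ⟶ X.p.obj x), ∃ (c : X.obj) (φ : c ⟶ x),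
      X.p.IsHomLift f φ)
    (hcart : ∀ (c x : X.obj) (l : c ⟶ x), X.p.IsStronglyCartesian (X.p.map l) l) :
    IsFiberedInGroupoids X where
  isFibered := Functor.IsFibered.of_exists_isStronglyCartesian fun x T f => by
    obtain ⟨c, φ, hφ⟩ := hlift x T f
    obtain rfl := IsHomLift.domain_eq X.p f φ
    obtain rfl := IsHomLift.eq_of_isHomLift X.p f φ
    exact ⟨c, φ, hcart _ _ φ⟩
  isGroupoid_fiber S := ⟨fun {a b} φ => by
    have hφ : X.p.IsHomLift (𝟙 S) φ.1 := φ.2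
    have h1 := hcart _ _ φ.1
    have h2 : IsIso (X.p.map φ.1) := by
      rw [IsHomLift.fac' X.p (𝟙 S) φ.1]
      infer_instance
    have h3 : IsIso φ.1 := Functor.IsStronglyCartesian.isIso_of_base_isIso X.p (X.p.map φ.1) φ.1
    exact ⟨⟨inv φ.1, inferInstance⟩, Subtype.ext (IsIso.hom_inv_id φ.1),
      Subtype.ext (IsIso.inv_hom_id φ.1)⟩⟩

/-! ### The gerbe of objects with a subsheaf of automorphisms. -/

section NormalizerGerbe

variable {G : BasedCategory.{v₁, u₁} C} {H : BasedCategory.{v₂, u₂} C}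

/-- A subsheaf of the automorphism sheaf of `y` is locally an image if it is locally isomorphic to
the automorphism sheaf of an object of `G`. -/
def LocallyImage (J : GrothendieckTopology C) (F : BasedFunctor G H) {y : H.obj}
    (A : AutSub H y) : Prop :=
  Locally J y (fun _ χ => ∃ (s : G.obj) (u : _ ⟶ F.obj s),
    A.restrict χ = (AutSub.image F s).restrict u)

theorem LocallyImage.restrict {F : BasedFunctor G H} {y : H.obj} {A : AutSub H y}
    (hA : LocallyImage J F A) {c : H.obj} (χ : c ⟶ y) : LocallyImage J F (A.restrict χ) :=
  (hA.pullback χ).mono fun _ _ ⟨s, w, h⟩ => ⟨s, w, by rw [AutSub.restrict_restrict, h]⟩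

theorem locallyImage_image (F : BasedFunctor G H) (s : G.obj) :
    LocallyImage J F (AutSub.image F s) :=
  Locally.of_forall fun _ χ => ⟨s, χ, rfl⟩

theorem LocallyImage.of_iso [IsFiberedInGroupoids G] [IsFiberedInGroupoids H]
    {F F' : BasedFunctor G H} (θ : F ≅ F') {y : H.obj} {A : AutSub H y}
    (hA : LocallyImage J F A) : LocallyImage J F' A :=
  hA.mono fun _ _ ⟨s, w, h⟩ => ⟨s, w ≫ θ.hom.toNatTrans.app s, by
    rw [h, AutSub.image_eq_restrict_app θ s, AutSub.restrict_restrict]⟩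

variable (J) in
/-- An object of the normalizer of `F`: an object of the target together with a subsheaf of its
automorphism sheaf which is locally the automorphism sheaf of an object of the source. -/
structure NormalizerObj (F : BasedFunctor G H) where
  /-- The underlying object. -/
  base : H.obj
  /-- The subsheaf of the automorphism sheaf. -/
  sub : AutSub H base
  isSheaf : sub.IsSheaf J
  locallyImage : LocallyImage J F sub

instance (F : BasedFunctor G H) : Category (NormalizerObj J F) where
  Hom A B := {l : A.base ⟶ B.base // A.sub = B.sub.restrict l}
  id A := ⟨𝟙 A.base, (AutSub.restrict_id _).symm⟩
  comp l m := ⟨l.1 ≫ m.1, by rw [← AutSub.restrict_restrict, ← m.2, ← l.2]⟩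
  id_comp _ := Subtype.ext (Category.id_comp _)
  comp_id _ := Subtype.ext (Category.comp_id _)
  assoc _ _ _ := Subtype.ext (Category.assoc _ _ _)

/-- The forgetful functor from the normalizer. -/
def NormalizerObj.forget (F : BasedFunctor G H) : NormalizerObj J F ⥤ H.obj where
  obj A := A.base
  map l := l.1

variable (J) in
/-- The normalizer of `F`, as a category over `C`. -/
def normalizerGerbe (F : BasedFunctor G H) : BasedCategory.{v₂, max u₂ v₂} C where
  obj := NormalizerObj J F
  p := NormalizerObj.forget F ⋙ H.p

variable (J) in
/-- The projection of the normalizer to the target. -/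
def normalizerForget (F : BasedFunctor G H) : BasedFunctor (normalizerGerbe J F) H where
  toFunctor := NormalizerObj.forget F
  w := rfl

theorem normalizerForget_faithful (F : BasedFunctor G H) :
    (normalizerForget J F).toFunctor.Faithful :=
  ⟨fun {_ _} _ _ h => Subtype.ext h⟩

theorem normalizerGerbe_isHomLift_iff {F : BasedFunctor G H} {x y : NormalizerObj J F} {S T : C}
    (f : S ⟶ T) (l : x ⟶ y) :
    (NormalizerObj.forget F ⋙ H.p).IsHomLift f l ↔ H.p.IsHomLift f l.1 :=
  ((normalizerForget J F).isHomLift_iff f l).symm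

/-- The pullback of an object of the normalizer along an arrow of the target. -/
def NormalizerObj.pullback {F : BasedFunctor G H} (x : NormalizerObj J F) {c : H.obj}
    (χ : c ⟶ x.base) : NormalizerObj J F where
  base := c
  sub := x.sub.restrict χ
  isSheaf := x.isSheaf.restrict χ
  locallyImage := x.locallyImage.restrict χ

instance normalizerGerbe_isFiberedInGroupoids [IsFiberedInGroupoids H] (F : BasedFunctor G H) :
    IsFiberedInGroupoids (normalizerGerbe J F) := by
  refine isFiberedInGroupoids_of_isStronglyCartesian ?_ ?_
  · intro (x : NormalizerObj J F) T (f : T ⟶ H.p.obj x.base)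
    obtain ⟨c, φ, hφ⟩ := exists_isHomLift (X := H) f rfl
    exact ⟨x.pullback φ, ⟨φ, rfl⟩, (normalizerGerbe_isHomLift_iff _ _).2 hφ⟩
  · intro (c : NormalizerObj J F) (x : NormalizerObj J F) l
    refine { toIsHomLift := IsHomLift.map _ _, universal_property' := ?_ }
    intro (d : NormalizerObj J F) (g : H.p.obj d.base ⟶ H.p.obj c.base) m hm
    have hm' : H.p.IsHomLift (g ≫ H.p.map l.1) m.1 := (normalizerGerbe_isHomLift_iff _ _).1 hm
    obtain ⟨k, hk, hkm⟩ := exists_factor g (H.p.map l.1) l.1 m.1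
    -- The factorization in `H` is automatically an arrow of pairs: compatibility with the
    -- subsheaves is inherited from `l` and `m`.
    refine ⟨⟨k, ?_⟩, ⟨(normalizerGerbe_isHomLift_iff _ _).2 hk, Subtype.ext hkm⟩, ?_⟩
    · rw [m.2, ← hkm, ← AutSub.restrict_restrict, ← l.2]
    · rintro k' ⟨hk', hk'm⟩
      have hk'' : H.p.IsHomLift g k'.1 := (normalizerGerbe_isHomLift_iff _ _).1 hk'
      exact Subtype.ext (hom_ext_of_comp g l.1 ((congrArg Subtype.val hk'm).trans hkm.symm))

/-- A faithful morphism whose automorphism sheaves are locally those of `F` factors through the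
normalizer of `F`. -/
def liftNormalizer {G' : BasedCategory.{v₃, u₃} C} [IsStackInGroupoids J G']
    [IsStackInGroupoids J H] (F : BasedFunctor G H) (F' : BasedFunctor G' H)
    (hF' : F'.toFunctor.Faithful) (h : ∀ s, LocallyImage J F (AutSub.image F' s)) :
    BasedFunctor G' (normalizerGerbe J F) where
  obj s := (⟨F'.obj s, AutSub.image F' s, AutSub.isSheaf_image F' hF' s, h s⟩ : NormalizerObj J F)
  map l := ⟨F'.map l, by
    have : IsFiberedInGroupoids G' := IsStackInGroupoids.toIsFiberedInGroupoids J
    have : IsFiberedInGroupoids H := IsStackInGroupoids.toIsFiberedInGroupoids J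
    exact AutSub.image_eq_restrict F' l⟩
  map_id s := Subtype.ext (F'.map_id s)
  map_comp l m := Subtype.ext (F'.map_comp l m)
  w := F'.w

/-- The canonical morphism to the normalizer. -/
def toNormalizer [IsStackInGroupoids J G] [IsStackInGroupoids J H] (F : BasedFunctor G H)
    (hF : F.toFunctor.Faithful) : BasedFunctor G (normalizerGerbe J F) :=
  liftNormalizer F F hF (locallyImage_image F)

/-- After passing to a pullback of the object of `G`, the local model of the subsheaf sits on an
object isomorphic to the image of an object of `G`, and the isomorphism is one of pairs. -/
theorem exists_sieve_toNormalizer [IsStackInGroupoids J G] [IsStackInGroupoids J H]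
    (F : BasedFunctor G H) (hF : F.toFunctor.Faithful) {S : C} (x : NormalizerObj J F)
    (hx : H.p.obj x.base = S) :
    ∃ R ∈ J S, ∀ ⦃T : C⦄ (f : T ⟶ S), R f → ∃ (s : G.obj)
      (ρ : (toNormalizer (J := J) F hF).obj s ⟶ x), (normalizerGerbe J F).p.IsHomLift f ρ := by
  have : IsFiberedInGroupoids G := IsStackInGroupoids.toIsFiberedInGroupoids J
  have : IsFiberedInGroupoids H := IsStackInGroupoids.toIsFiberedInGroupoids J
  obtain ⟨R, hR, h⟩ := x.locallyImage.exists_sieve hx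
  refine ⟨R, hR, fun T f hf => ?_⟩
  obtain ⟨c, χ, hχ⟩ := exists_isHomLift f hx
  obtain ⟨s, w, hw⟩ := h f hf c χ hχ
  obtain ⟨d, φ, ι, hι, rfl⟩ := exists_iso_map F w
  rw [IsHomLift.domain_eq H.p f χ] at hι
  have e : AutSub.image F d = x.sub.restrict (ι.inv ≫ χ) := by
    rw [← AutSub.restrict_restrict, hw, AutSub.restrict_restrict, Iso.inv_hom_id_assoc]
    exact AutSub.image_eq_restrict F φ
  have e' : H.p.IsHomLift f (ι.inv ≫ χ) := inferInstance
  exact ⟨d, ⟨ι.inv ≫ χ, e⟩, (normalizerGerbe_isHomLift_iff _ _).2 e'⟩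

theorem normalizerGerbe_isStackInGroupoids [IsStackInGroupoids J G] [IsStackInGroupoids J H]
    (F : BasedFunctor G H) : IsStackInGroupoids J (normalizerGerbe J F) := by
  have : IsFiberedInGroupoids G := IsStackInGroupoids.toIsFiberedInGroupoids J
  have : IsFiberedInGroupoids H := IsStackInGroupoids.toIsFiberedInGroupoids J
  refine { existsUnique_glue := ?_, exists_descent := ?_ }
  · intro (x : NormalizerObj J F) (y : NormalizerObj J F) hxy R hR m hm hm'
    replace hR : R ∈ J (H.p.obj x.base) := hR
    have e1 : ∀ ⦃c c' : NormalizerObj J F⦄ (φ : c ⟶ x) (φ' : c' ⟶ x) (l : c ⟶ c')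
        (h : R (H.p.map φ.1)) (h' : R (H.p.map φ'.1)), l ≫ φ' = φ → m φ h = l ≫ m φ' h' := by
      rintro c c' φ φ' l h h' rfl
      exact hm' φ' l h' h
    -- Each arrow of `H` into `x.base` underlies an arrow of pairs from the pulled back pair, so the
    -- given family induces one in `H`.
    let n : ∀ ⦃c : H.obj⦄ (φ : c ⟶ x.base), R (H.p.map φ) → (c ⟶ y.base) := fun c φ h =>
      (m (c := x.pullback φ) ⟨φ, rfl⟩ h).1
    have hn : ∀ ⦃c : H.obj⦄ (φ : c ⟶ x.base) (h : R (H.p.map φ)),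
        x.sub.restrict φ = y.sub.restrict (n φ h) := fun c φ h =>
      (m (c := x.pullback φ) ⟨φ, rfl⟩ h).2
    have e2 : ∀ ⦃c : NormalizerObj J F⦄ (φ : c ⟶ x) (h : R (H.p.map φ.1)),
        (m φ h).1 = n φ.1 h := fun c φ h => by
      -- The source of `φ` and the pulled back pair have the same base and equal subsheaves, so the
      -- identity of the base is an arrow between them.
      rw [e1 φ (c' := x.pullback φ.1) ⟨φ.1, rfl⟩ ⟨𝟙 _, φ.2.trans
        (AutSub.restrict_id _).symm⟩ h h (Subtype.ext (Category.id_comp _))]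
      exact Category.id_comp _
    obtain ⟨μ, ⟨hμ, hμ'⟩, huniq⟩ := IsStackInGroupoids.existsUnique_glue (J := J) x.base y.base hxy
      R hR n (fun c φ h =>
        (normalizerGerbe_isHomLift_iff _ _).1 (hm (c := x.pullback φ) ⟨φ, rfl⟩ h)) (fun c d φ l h h' => by
        exact congrArg Subtype.val (e1 (c := x.pullback (l ≫ φ)) (c' := x.pullback φ) ⟨l ≫ φ, rfl⟩
          ⟨φ, rfl⟩ ⟨l, (AutSub.restrict_restrict _ _ _).symm⟩ h' h rfl))
    have hsub : x.sub = y.sub.restrict μ := x.isSheaf.ext_of_locally (y.isSheaf.restrict μ)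
      ⟨R, hR, fun c φ h => by
        change x.sub.restrict φ = (y.sub.restrict μ).restrict φ
        rw [AutSub.restrict_restrict, hμ' φ h, hn φ h]⟩
    refine ⟨⟨μ, hsub⟩, ⟨(normalizerGerbe_isHomLift_iff _ _).2 hμ, fun c φ h => Subtype.ext ?_⟩, ?_⟩
    · exact (hμ' φ.1 h).trans (e2 φ h).symm
    · rintro ν ⟨hν, hν'⟩
      refine Subtype.ext (huniq ν.1 ⟨(normalizerGerbe_isHomLift_iff _ _).1 hν, fun c φ h => ?_⟩)
      exact congrArg Subtype.val (hν' (c := x.pullback φ) ⟨φ, rfl⟩ h)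
  · intro S R hR D
    let B : R.arrows.category → NormalizerObj J F := D.obj
    let δ : ∀ {f g : R.arrows.category} (_ : f ⟶ g), B f ⟶ B g := fun k => D.map k
    let D' : BasedFunctor (sieveBased R) H := BasedFunctor.comp D (normalizerForget J F)
    have hδ : ∀ {f g : R.arrows.category} (k : f ⟶ g), H.p.IsHomLift k.hom.left (δ k).1 :=
      fun {f g} k => inferInstanceAs (H.p.IsHomLift ((sieveBased R).p.map k) (D'.map k))
    have h1 : ∃ (y : H.obj) (π : ∀ f : R.arrows.category, (B f).base ⟶ y), H.p.obj y = S ∧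
        (∀ f : R.arrows.category, H.p.IsHomLift f.obj.hom (π f)) ∧
        ∀ (f g : R.arrows.category) (k : f ⟶ g), (δ k).1 ≫ π g = π f := by
      obtain ⟨x, π, hx, hπ, hπD⟩ := IsStackInGroupoids.exists_descent (J := J) S R hR D'
      exact ⟨x, π, hx, hπ, hπD⟩
    obtain ⟨y, π, hy, hπ, hπδ⟩ := h1
    have hB : ∀ f, H.p.obj (B f).base = f.obj.left := fun f => by
      have := hπ f
      exact IsHomLift.domain_eq H.p f.obj.hom (π f)
    -- All factorizations of an arrow through the descent datum induce the same subsheaf on its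
    -- source; this is the overlap condition for gluing the subsheaves.
    have h2 : ∀ ⦃d : H.obj⦄ ⦃T : C⦄ (m : d ⟶ y) (f : T ⟶ S) (hf : R f), H.p.IsHomLift f m →
        ∃ (o : R.arrows.category) (j : d ⟶ (B o).base), j ≫ π o = m ∧
        ∀ (g : R.arrows.category) (k : d ⟶ (B g).base), k ≫ π g = m →
          (B g).sub.restrict k = (B o).sub.restrict j := by
      intro d T m f hf hm
      let o : R.arrows.category := ⟨Over.mk f, hf⟩
      have : H.p.IsHomLift f (π o) := hπ o
      obtain ⟨j, hj, hjm⟩ := exists_iso_factor f (π o) m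
      refine ⟨o, j.hom, hjm, fun g k hk => ?_⟩
      let a : T ⟶ g.obj.left := eqToHom (IsHomLift.domain_eq H.p f m).symm ≫ H.p.map k ≫
        eqToHom (hB g)
      have ha : H.p.IsHomLift a k := inferInstance
      have hπg := hπ g
      have haf : a ≫ g.obj.hom = f := by
        have h1 : H.p.IsHomLift (a ≫ g.obj.hom) m := by
          rw [← hk]
          exact IsHomLift.comp H.p a g.obj.hom k (π g)
        rw [IsHomLift.fac H.p f m, IsHomLift.fac H.p (a ≫ g.obj.hom) m]
      let α : o ⟶ g := ⟨Over.homMk a haf⟩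
      have h3 : k = j.hom ≫ (δ α).1 := by
        have : H.p.IsHomLift a (δ α).1 := hδ α
        refine hom_ext_of_comp a (π g) ?_
        rw [hk, Category.assoc, hπδ, hjm]
      rw [h3, ← AutSub.restrict_restrict, ← (δ α).2]
    have h2' : ∀ (d : H.obj) (g : R.arrows.category) (k : d ⟶ (B g).base),
        ∃ (T : C) (f : T ⟶ S), R f ∧ H.p.IsHomLift f (k ≫ π g) := fun d g k => by
      have := hπ g
      exact ⟨_, (H.p.map k ≫ eqToHom (hB g)) ≫ g.obj.hom, R.downward_closed g.property _,
        IsHomLift.comp H.p _ _ _ _⟩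
    obtain ⟨A, hA, hAπ⟩ := AutSub.exists_isSheaf_restrict_eq (J := J) π (fun f => (B f).sub)
      (fun f => (B f).isSheaf) (fun f g d k k' hkk' => by
        obtain ⟨T, f', hf', hl⟩ := h2' d f k
        obtain ⟨o, j, -, h⟩ := h2 (k ≫ π f) f' hf' hl
        rw [h f k rfl, h g k' hkk'.symm])
    have hloc : LocallyImage J F A := by
      have h3 : Locally J y (fun c χ => ∃ (o : R.arrows.category) (j : c ⟶ (B o).base),
          j ≫ π o = χ) := Locally.of_sieve hy hR fun T f hf c χ hχ => by
        obtain ⟨o, j, h, -⟩ := h2 χ f hf hχ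
        exact ⟨o, j, h⟩
      refine h3.trans ?_
      rintro c _ ⟨o, j, rfl⟩
      have := (B o).locallyImage.restrict j
      rw [← hAπ o, AutSub.restrict_restrict] at this
      refine this.mono fun d l ⟨s, w, h⟩ => ⟨s, w, ?_⟩
      rw [← h, AutSub.restrict_restrict]
    exact ⟨(⟨y, A, hA, hloc⟩ : NormalizerObj J F), fun f => ⟨π f, (hAπ f).symm⟩, hy,
      fun f => (normalizerGerbe_isHomLift_iff _ _).2 (hπ f), fun f g k => Subtype.ext (hπδ f g k)⟩

theorem normalizerGerbe_isGerbe (hG : IsGerbe J G) (hH : IsGerbe J H) (F : BasedFunctor G H)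
    (hF : F.toFunctor.Faithful) : IsGerbe J (normalizerGerbe J F) := by
  have : IsFiberedInGroupoids H := IsStackInGroupoids.toIsFiberedInGroupoids J
  have := normalizerGerbe_isStackInGroupoids (J := J) F
  refine { locally_nonempty := ?_, locally_isomorphic := ?_ }
  · intro S
    obtain ⟨R, hR, h⟩ := IsGerbe.locally_nonempty (J := J) (X := G) S
    refine ⟨R, hR, fun T f hf => ?_⟩
    obtain ⟨s, hs⟩ := h f hf
    exact ⟨(toNormalizer F hF).obj s, ((toNormalizer F hF).w_obj s).trans hs⟩
  · intro S x y hx hy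
    -- The sieve of all arrows where the conclusion holds. It covers by transitivity: both pairs
    -- come locally from `G`, where objects are locally isomorphic.
    let R₀ : Sieve S :=
      { arrows := fun T f => ∃ (c : (normalizerGerbe J F).obj) (φ : c ⟶ x) (ψ : c ⟶ y),
          (normalizerGerbe J F).p.IsHomLift f φ ∧ (normalizerGerbe J F).p.IsHomLift f ψ
        downward_closed := by
          rintro T T' f ⟨c, φ, ψ, hφ, hψ⟩ g
          obtain ⟨d, l, hl⟩ := exists_isHomLift g
            (IsHomLift.domain_eq (normalizerGerbe J F).p f φ)
          exact ⟨d, l ≫ φ, l ≫ ψ, inferInstance, inferInstance⟩ }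
    refine ⟨R₀, ?_, fun T f hf => hf⟩
    obtain ⟨R₁, hR₁, h₁⟩ := exists_sieve_toNormalizer F hF x hx
    obtain ⟨R₂, hR₂, h₂⟩ := exists_sieve_toNormalizer F hF y hy
    refine J.transitive (J.intersection_covering hR₁ hR₂) _ fun T f hf => ?_
    obtain ⟨s, ρ, hρ⟩ := h₁ f hf.1
    obtain ⟨s', ρ', hρ'⟩ := h₂ f hf.2
    have hs : G.p.obj s = T := ((toNormalizer (J := J) F hF).w_obj s).symm.trans
      (IsHomLift.domain_eq (normalizerGerbe J F).p f ρ)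
    have hs' : G.p.obj s' = T := ((toNormalizer (J := J) F hF).w_obj s').symm.trans
      (IsHomLift.domain_eq (normalizerGerbe J F).p f ρ')
    obtain ⟨R₃, hR₃, h₃⟩ := IsGerbe.locally_isomorphic (J := J) T s s' hs hs'
    refine J.superset_covering (fun U g hg => ?_) hR₃
    obtain ⟨c, φ, ψ, hφ, hψ⟩ := h₃ g hg
    exact ⟨_, (toNormalizer F hF).map φ ≫ ρ, (toNormalizer F hF).map ψ ≫ ρ', inferInstance,
      inferInstance⟩

/-- An arrow of the target lifts to the normalizer if and only if it is compatible with the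
subsheaves. -/
theorem exists_normalizerForget_map_eq_iff (F : BasedFunctor G H) (x y : NormalizerObj J F)
    (l : x.base ⟶ y.base) :
    (∃ m : x ⟶ y, (normalizerForget J F).map m = l) ↔ x.sub = y.sub.restrict l :=
  ⟨fun ⟨m, hm⟩ => hm ▸ m.2, fun h => ⟨⟨l, h⟩, rfl⟩⟩

theorem isNormalizer_normalizerGerbe (hG : IsGerbe J G) (hH : IsGerbe J H) (F : BasedFunctor G H)
    (hF : F.toFunctor.Faithful) :
    IsNormalizer J (toNormalizer (J := J) F hF) (normalizerForget J F) where
  isGerbe := normalizerGerbe_isGerbe hG hH F hF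
  faithful_left := ⟨fun {_ _} _ _ h => hF.map_injective (congrArg Subtype.val h)⟩
  faithful_right := normalizerForget_faithful F
  image_eq s := by
    have : IsFiberedInGroupoids H := IsStackInGroupoids.toIsFiberedInGroupoids J
    exact AutSub.image_eq_normalizer (normalizerForget J F) (fun x => NormalizerObj.sub x)
      (exists_normalizerForget_map_eq_iff F) ((toNormalizer F hF).obj s)

end NormalizerGerbe

/-! ### Local isomorphisms in gerbes -/

section Gerbe

variable {X : BasedCategory.{v₁, u₁} C} {Y : BasedCategory.{v₂, u₂} C}

theorem locally_exists_hom [IsGerbe J X] (x y : X.obj) (h : X.p.obj y = X.p.obj x) :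
    Locally J x (fun c φ => ∃ ψ : c ⟶ y, X.p.IsHomLift (X.p.map φ) ψ) := by
  have : IsFiberedInGroupoids X := IsStackInGroupoids.toIsFiberedInGroupoids J
  obtain ⟨R, hR, H⟩ := IsGerbe.locally_isomorphic (J := J) _ x y rfl h
  refine ⟨R, hR, fun c χ hχ => ?_⟩
  obtain ⟨d, φ, ψ, hφ, hψ⟩ := H _ hχ
  obtain ⟨k, hk, -⟩ := exists_iso_factor (X.p.map χ) φ χ
  exact ⟨k.hom ≫ ψ, inferInstance⟩

/-- Every object of a gerbe is locally in the image of a morphism of gerbes. -/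
theorem exists_sieve_map (hX : IsGerbe J X) (hY : IsGerbe J Y) (F : BasedFunctor X Y) {S : C}
    (y : Y.obj) (hy : Y.p.obj y = S) :
    ∃ R ∈ J S, ∀ ⦃T : C⦄ (f : T ⟶ S), R f → ∃ (s : X.obj) (ρ : F.obj s ⟶ y),
      Y.p.IsHomLift f ρ := by
  have : IsFiberedInGroupoids X := IsStackInGroupoids.toIsFiberedInGroupoids J
  have : IsFiberedInGroupoids Y := IsStackInGroupoids.toIsFiberedInGroupoids J
  let R₀ : Sieve S :=
    { arrows := fun T f => ∃ (s : X.obj) (ρ : F.obj s ⟶ y), Y.p.IsHomLift f ρ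
      downward_closed := by
        rintro T T' f ⟨s, ρ, hρ⟩ g
        obtain ⟨d, l, hl⟩ := exists_isHomLift g
          ((F.w_obj s).symm.trans (IsHomLift.domain_eq Y.p f ρ))
        exact ⟨d, F.map l ≫ ρ, inferInstance⟩ }
  refine ⟨R₀, ?_, fun T f hf => hf⟩
  obtain ⟨R₁, hR₁, h₁⟩ := IsGerbe.locally_nonempty (J := J) (X := X) S
  refine J.transitive hR₁ _ fun T f hf => ?_
  obtain ⟨s, hs⟩ := h₁ f hf
  obtain ⟨c, χ, hχ⟩ := exists_isHomLift f hy
  obtain ⟨R₂, hR₂, h₂⟩ := IsGerbe.locally_isomorphic (J := J) T (F.obj s) c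
    ((F.w_obj s).trans hs) (IsHomLift.domain_eq Y.p f χ)
  refine J.superset_covering (fun U g hg => ?_) hR₂
  obtain ⟨d, φ, ψ, hφ, hψ⟩ := h₂ g hg
  obtain ⟨t, σ, hσ⟩ := exists_isHomLift g hs
  obtain ⟨k, hk, -⟩ := exists_iso_factor g φ (F.map σ)
  exact ⟨t, k.hom ≫ ψ ≫ χ, inferInstance⟩

theorem locally_exists_iso_map (hX : IsGerbe J X) (hY : IsGerbe J Y) (F : BasedFunctor X Y)
    (y : Y.obj) : Locally J y (fun c _ => ∃ s : X.obj, Nonempty (c ≅ F.obj s)) := by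
  have : IsFiberedInGroupoids Y := IsStackInGroupoids.toIsFiberedInGroupoids J
  obtain ⟨R, hR, h⟩ := exists_sieve_map hX hY F y rfl
  refine ⟨R, hR, fun c χ hχ => ?_⟩
  obtain ⟨s, ρ, hρ⟩ := h _ hχ
  obtain ⟨k, -, -⟩ := exists_iso_factor (Y.p.map χ) ρ χ
  exact ⟨s, ⟨k⟩⟩

end Gerbe

/-! ### Comparison with the normalizer -/

section Comparison

variable {G : BasedCategory.{v₁, u₁} C} {N : BasedCategory.{v₂, u₂} C}
  {H : BasedCategory.{v₃, u₃} C} {Φ : BasedFunctor G N} {Ψ : BasedFunctor N H}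

variable (Φ Ψ) in
/-- The image of the automorphism sheaf of `s` in the automorphism sheaf of `Ψ (Φ s)`. -/
def compImage (s : G.obj) : AutSub H (Ψ.obj (Φ.obj s)) :=
  AutSub.image (BasedFunctor.comp Φ Ψ) s

theorem compImage_eq_restrict [IsFiberedInGroupoids G] [IsFiberedInGroupoids H] {s s' : G.obj}
    (l : s ⟶ s') : compImage Φ Ψ s = (compImage Φ Ψ s').restrict (Ψ.map (Φ.map l)) :=
  AutSub.image_eq_restrict (BasedFunctor.comp Φ Ψ) l

theorem exists_iso_map_map [IsFiberedInGroupoids G] [IsFiberedInGroupoids H] {s : G.obj}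
    {d : H.obj} (k : d ⟶ Ψ.obj (Φ.obj s)) :
    ∃ (t : G.obj) (σ : t ⟶ s) (ι : d ≅ Ψ.obj (Φ.obj t)), ι.hom ≫ Ψ.map (Φ.map σ) = k := by
  obtain ⟨t, σ, ι, -, h⟩ := exists_iso_map (BasedFunctor.comp Φ Ψ) k
  exact ⟨t, σ, ι, h⟩

/-- Property (2) evaluated at the identity pullback. Both uses of (2) in the comparison go through
this form: arrows of `N` normalize, and normalizing automorphisms lie in `N`. -/
theorem IsNormalizer.restrict_image_eq_iff [IsFiberedInGroupoids N] [IsFiberedInGroupoids H]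
    (hN : IsNormalizer J Φ Ψ) {s : G.obj} {S : C} (k : Ψ.obj (Φ.obj s) ⟶ Ψ.obj (Φ.obj s))
    [H.p.IsHomLift (𝟙 S) k] :
    (compImage Φ Ψ s).restrict k = compImage Φ Ψ s ↔
      ∃ m : Φ.obj s ⟶ Φ.obj s, Ψ.map m = k := by
  obtain ⟨a, rfl⟩ := exists_mem_vAut (S := S) k
  have h1 : a ∈ (AutSub.image Ψ (Φ.obj s)).sections (𝟙 (Ψ.obj (Φ.obj s))) ↔
      (compImage Φ Ψ s).restrict a.1.hom = compImage Φ Ψ s := by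
    have h := AutSub.mem_normalizer_iff (compImage Φ Ψ s) (𝟙 (Ψ.obj (Φ.obj s))) a
    rw [AutSub.restrict_id] at h
    rw [hN.image_eq]
    exact h
  have h2 : 𝟙 (Ψ.obj (Φ.obj s)) = (Iso.refl (Ψ.obj (Φ.obj s))).hom ≫ Ψ.map (𝟙 (Φ.obj s)) := by
    simp
  refine h1.symm.trans ?_
  rw [h2, AutSub.mem_image_iff]
  constructor
  · rintro ⟨b, hb⟩
    exact ⟨b.1.hom, (Category.id_comp _).symm.trans (hb.symm.trans (Category.comp_id _))⟩
  · rintro ⟨m, hm⟩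
    have : N.p.IsHomLift (𝟙 S) m := by
      rw [← Ψ.isHomLift_iff, hm]
      infer_instance
    obtain ⟨b, rfl⟩ := exists_mem_vAut (S := S) m
    exact ⟨b, (Category.comp_id _).trans (hm.symm.trans (Category.id_comp _).symm)⟩

theorem IsNormalizer.isSheaf_image (hG : IsGerbe J G) (hH : IsGerbe J H)
    (hN : IsNormalizer J Φ Ψ) (s : G.obj) :
    (compImage Φ Ψ s).IsSheaf J := by
  have := hN.faithful_left
  have := hN.faithful_right
  exact AutSub.isSheaf_image _ (inferInstanceAs (Φ.toFunctor ⋙ Ψ.toFunctor).Faithful) s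

/-- Arrows between objects coming from `G` are compatible with the automorphism sheaves. -/
theorem IsNormalizer.image_eq_restrict (hG : IsGerbe J G) (hH : IsGerbe J H)
    (hN : IsNormalizer J Φ Ψ) {t t' : G.obj} (n : Φ.obj t ⟶ Φ.obj t') :
    compImage Φ Ψ t =
      (compImage Φ Ψ t').restrict (Ψ.map n) := by
  have := hN.isGerbe
  have : IsFiberedInGroupoids G := IsStackInGroupoids.toIsFiberedInGroupoids J
  have : IsFiberedInGroupoids H := IsStackInGroupoids.toIsFiberedInGroupoids J
  have : IsFiberedInGroupoids N := IsStackInGroupoids.toIsFiberedInGroupoids J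
  let f : G.p.obj t ⟶ G.p.obj t' := eqToHom (Φ.w_obj t).symm ≫ N.p.map n ≫ eqToHom (Φ.w_obj t')
  have hf : N.p.IsHomLift f n := inferInstance
  obtain ⟨z, π, hπ⟩ := exists_isHomLift (X := G) f rfl
  obtain ⟨n', hn', rfl⟩ := exists_iso_factor f (Φ.map π) n
  have hz : G.p.obj z = G.p.obj t := IsHomLift.domain_eq G.p f π
  rw [Ψ.map_comp, ← AutSub.restrict_restrict, ← compImage_eq_restrict]
  have h1 : Locally J (Ψ.obj (Φ.obj t)) (fun d χ => ∃ (c : G.obj) (φ : c ⟶ t)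
      (ι : d ≅ Ψ.obj (Φ.obj c)), ι.hom ≫ Ψ.map (Φ.map φ) = χ ∧
        ∃ ψ : c ⟶ z, G.p.IsHomLift (G.p.map φ) ψ) :=
    (locally_exists_hom t z hz).map (BasedFunctor.comp Φ Ψ)
  refine (hN.isSheaf_image hG hH t).ext_of_locally ((hN.isSheaf_image hG hH z).restrict _)
    (h1.mono ?_)
  rintro d _ ⟨c, φ, ι, rfl, ψ, hψ⟩
  -- Two arrows of `N` over the same base arrow differ by a vertical automorphism `k`, which
  -- preserves the automorphism sheaf of `c` by property (2).
  obtain ⟨k, hk, hkψ⟩ := exists_iso_factor (G.p.map φ) (Φ.map ψ) (Φ.map φ ≫ n'.hom)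
  have e1 := (hN.restrict_image_eq_iff (S := G.p.obj c) (Ψ.map k.hom)).2 ⟨k.hom, rfl⟩
  have e2 : Ψ.map (Φ.map φ) ≫ Ψ.map n'.hom = Ψ.map k.hom ≫ Ψ.map (Φ.map ψ) := by
    rw [← Ψ.map_comp, ← hkψ, Ψ.map_comp]
  rw [AutSub.restrict_restrict, Category.assoc, e2, ← AutSub.restrict_restrict,
    ← compImage_eq_restrict, ← AutSub.restrict_restrict, ← AutSub.restrict_restrict,
    ← compImage_eq_restrict, e1]

/-- The automorphism sheaves of the objects of `G` descend to subsheaves on the objects of a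
normalizer. -/
theorem IsNormalizer.exists_sub (hG : IsGerbe J G) (hH : IsGerbe J H) (hN : IsNormalizer J Φ Ψ)
    (x : N.obj) :
    ∃ A : AutSub H (Ψ.obj x), A.IsSheaf J ∧ ∀ (s : G.obj) (ν : Φ.obj s ⟶ x),
      A.restrict (Ψ.map ν) = compImage Φ Ψ s := by
  have := hN.isGerbe
  have : IsFiberedInGroupoids G := IsStackInGroupoids.toIsFiberedInGroupoids J
  have : IsFiberedInGroupoids H := IsStackInGroupoids.toIsFiberedInGroupoids J
  have : IsFiberedInGroupoids N := IsStackInGroupoids.toIsFiberedInGroupoids J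
  -- The gluing family is indexed by all arrows to `x` from objects coming from `G`, so no covering
  -- is chosen. On an overlap, the comparison arrow lifts to `N` by cartesianness.
  obtain ⟨A, hA, h⟩ := AutSub.exists_isSheaf_restrict_eq (J := J) (I := Σ s : G.obj, (Φ.obj s ⟶ x))
    (fun i => Ψ.map i.2) (fun i => compImage Φ Ψ i.1)
    (fun i => hN.isSheaf_image hG hH i.1) (by
      rintro ⟨s, ν⟩ ⟨s', ν'⟩ d k k' hkk'
      replace hkk' : k ≫ Ψ.map ν = k' ≫ Ψ.map ν' := hkk'
      change (compImage Φ Ψ s).restrict k = (compImage Φ Ψ s').restrict k'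
      obtain ⟨t, σ, ι, rfl⟩ := exists_iso_map_map k
      obtain ⟨t', σ', ι', rfl⟩ := exists_iso_map_map k'
      obtain ⟨n, -, hn⟩ := exists_map_eq Ψ (Φ.map σ ≫ ν) (Φ.map σ' ≫ ν') (ι.inv ≫ ι'.hom) (by
        rw [Category.assoc, Iso.inv_comp_eq, Ψ.map_comp, Ψ.map_comp]
        simpa using hkk'.symm)
      rw [← AutSub.restrict_restrict, ← AutSub.restrict_restrict, ← compImage_eq_restrict,
        ← compImage_eq_restrict, hN.image_eq_restrict hG hH n, hn, AutSub.restrict_restrict,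
        Iso.hom_inv_id_assoc])
  exact ⟨A, hA, fun s ν => h ⟨s, ν⟩⟩

theorem IsNormalizer.locally_factor (hG : IsGerbe J G) (hH : IsGerbe J H)
    (hN : IsNormalizer J Φ Ψ) (x : N.obj) :
    Locally J (Ψ.obj x) (fun d χ => ∃ (s : G.obj) (w : d ⟶ Ψ.obj (Φ.obj s)) (ν : Φ.obj s ⟶ x),
      w ≫ Ψ.map ν = χ) := by
  have := hN.isGerbe
  have : IsFiberedInGroupoids H := IsStackInGroupoids.toIsFiberedInGroupoids J
  have : IsFiberedInGroupoids N := IsStackInGroupoids.toIsFiberedInGroupoids J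
  refine ((locally_exists_iso_map hG hN.isGerbe Φ x).map Ψ).mono ?_
  rintro d _ ⟨c, φ, ι, rfl, s, ⟨j⟩⟩
  exact ⟨s, ι.hom ≫ Ψ.map j.hom, j.inv ≫ φ, by simp [← Functor.map_comp]⟩

/-- A normalizer consists of the objects of the target equipped with a subsheaf of their
automorphism sheaf which is locally an automorphism sheaf of an object of the source. -/
theorem IsNormalizer.exists_family (hG : IsGerbe J G) (hH : IsGerbe J H)
    (hN : IsNormalizer J Φ Ψ) :
    ∃ A : ∀ x : N.obj, AutSub H (Ψ.obj x), (∀ x, (A x).IsSheaf J) ∧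
      (∀ x, LocallyImage J (BasedFunctor.comp Φ Ψ) (A x)) ∧
      (∀ s, A (Φ.obj s) = compImage Φ Ψ s) ∧
      ∀ (x y : N.obj) (l : Ψ.obj x ⟶ Ψ.obj y),
        (∃ m : x ⟶ y, Ψ.map m = l) ↔ A x = (A y).restrict l := by
  have := hN.isGerbe
  have : IsFiberedInGroupoids G := IsStackInGroupoids.toIsFiberedInGroupoids J
  have : IsFiberedInGroupoids H := IsStackInGroupoids.toIsFiberedInGroupoids J
  have : IsFiberedInGroupoids N := IsStackInGroupoids.toIsFiberedInGroupoids J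
  choose A hA hAν using hN.exists_sub hG hH
  have hmap : ∀ {x y : N.obj} (m : x ⟶ y), A x = (A y).restrict (Ψ.map m) := by
    intro x y m
    refine (hA x).ext_of_locally ((hA y).restrict _) ((hN.locally_factor hG hH x).mono ?_)
    rintro d _ ⟨s, w, ν, rfl⟩
    rw [← AutSub.restrict_restrict, hAν, AutSub.restrict_restrict, Category.assoc, ← Ψ.map_comp,
      ← AutSub.restrict_restrict, hAν]
  refine ⟨A, hA, fun x => ?_, fun s => ?_, fun x y l => ⟨?_, fun h => ?_⟩⟩
  · refine (hN.locally_factor hG hH x).mono ?_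
    rintro d _ ⟨s, w, ν, rfl⟩
    refine ⟨s, w, ?_⟩
    rw [← AutSub.restrict_restrict, hAν]
    rfl
  · rw [← hAν (Φ.obj s) s (𝟙 _), Ψ.map_id, AutSub.restrict_id]
  · rintro ⟨m, rfl⟩
    exact hmap m
  let f : N.p.obj x ⟶ N.p.obj y := eqToHom (Ψ.w_obj x).symm ≫ H.p.map l ≫ eqToHom (Ψ.w_obj y)
  have hf : H.p.IsHomLift f l := inferInstance
  obtain ⟨z, π, hπ⟩ := exists_isHomLift (X := N) f rfl
  obtain ⟨l', hl', rfl⟩ := exists_iso_factor f (Ψ.map π) l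
  have hz : N.p.obj z = N.p.obj x := IsHomLift.domain_eq N.p f π
  rw [← AutSub.restrict_restrict, ← hmap] at h
  suffices h' : ∃ m : x ⟶ z, Ψ.map m = l'.hom by
    obtain ⟨m, hm⟩ := h'
    exact ⟨m ≫ π, by rw [Ψ.map_comp, hm]⟩
  refine exists_map_eq_of_locally (J := J) Ψ hN.faithful_right l'.hom
    (((locally_exists_iso_map hG hN.isGerbe Φ x).and (locally_exists_hom x z hz)).mono ?_)
  rintro c φ ⟨⟨s, ⟨j⟩⟩, ψ, hψ⟩
  -- Locally the given arrow of `H` differs from an arrow of `N` by an automorphism `k` over an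
  -- object coming from `G`. Compatibility with the subsheaves makes `k` normalizing, so it lifts to
  -- `N`.
  obtain ⟨k, hk, hkψ⟩ := exists_iso_factor (N.p.map j.inv ≫ N.p.map φ) (Ψ.map (j.inv ≫ ψ))
    (Ψ.map (j.inv ≫ φ) ≫ l'.hom)
  obtain ⟨m, hm⟩ := (hN.restrict_image_eq_iff (S := N.p.obj (Φ.obj s)) k.hom).1 (by
    rw [← hAν z s (j.inv ≫ ψ), AutSub.restrict_restrict, hkψ, ← AutSub.restrict_restrict, ← h,
      hAν, hAν])
  refine ⟨j.hom ≫ m ≫ j.inv ≫ ψ, ?_⟩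
  rw [Ψ.map_comp, Ψ.map_comp, hm, hkψ, ← Category.assoc, ← Ψ.map_comp, Iso.hom_inv_id_assoc]

end Comparison

/-! ### Whiskering of 2-isomorphisms and their components. -/

section Whiskering

variable {X : BasedCategory.{v₁, u₁} C} {Y : BasedCategory.{v₂, u₂} C}
  {Z : BasedCategory.{v₃, u₃} C}

/-- Left whiskering of an invertible `2`-morphism. -/
def isoWhiskerLeft (F : BasedFunctor X Y) {P Q : BasedFunctor Y Z} (α : P ≅ Q) :
    BasedFunctor.comp F P ≅ BasedFunctor.comp F Q :=
  BasedNatIso.mkNatIso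
    (Functor.isoWhiskerLeft F.toFunctor ((BasedNatTrans.forgetful Y Z).mapIso α))
    (BasedCategory.whiskerLeft F α.hom).isHomLift'

/-- Right whiskering of an invertible `2`-morphism. -/
def isoWhiskerRight {P Q : BasedFunctor X Y} (α : P ≅ Q) (F : BasedFunctor Y Z) :
    BasedFunctor.comp P F ≅ BasedFunctor.comp Q F :=
  BasedNatIso.mkNatIso
    (Functor.isoWhiskerRight ((BasedNatTrans.forgetful X Y).mapIso α) F.toFunctor)
    (BasedCategory.whiskerRight α.hom F).isHomLift'

theorem app_hom_comp_inv {P Q : BasedFunctor X Y} (α : P ≅ Q) (x : X.obj) :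
    α.hom.toNatTrans.app x ≫ α.inv.toNatTrans.app x = 𝟙 (P.obj x) :=
  ((BasedNatTrans.forgetful X Y).mapIso α).hom_inv_id_app x

theorem app_inv_comp_hom {P Q : BasedFunctor X Y} (α : P ≅ Q) (x : X.obj) :
    α.inv.toNatTrans.app x ≫ α.hom.toNatTrans.app x = 𝟙 (Q.obj x) :=
  ((BasedNatTrans.forgetful X Y).mapIso α).inv_hom_id_app x

theorem faithful_of_comp_iso {F : BasedFunctor X Y} {P : BasedFunctor Y Z} {Q : BasedFunctor X Z}
    (α : BasedFunctor.comp F P ≅ Q) (hQ : Q.toFunctor.Faithful) : F.toFunctor.Faithful := by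
  have : ((BasedNatTrans.forgetful X Z).obj Q).Faithful := hQ
  have : (F.toFunctor ⋙ P.toFunctor).Faithful :=
    Functor.Faithful.of_iso ((BasedNatTrans.forgetful X Z).mapIso α).symm
  exact Functor.Faithful.of_comp F.toFunctor P.toFunctor

end Whiskering

/-! ### Equivalence of an arbitrary normalizer with the gerbe of pairs. -/

section Comparison

variable {G : BasedCategory.{v₁, u₁} C} {H : BasedCategory.{v₂, u₂} C}
  {N : BasedCategory.{v₃, u₃} C}

/-- A family of subsheaves compatible with the arrows of `N` defines a morphism to the
normalizer. -/
def comparison (F : BasedFunctor G H) (Ψ : BasedFunctor N H) (A : ∀ x : N.obj, AutSub H (Ψ.obj x))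
    (hA : ∀ x, (A x).IsSheaf J) (hA' : ∀ x, LocallyImage J F (A x))
    (hmap : ∀ {x y : N.obj} (m : x ⟶ y), A x = (A y).restrict (Ψ.map m)) :
    BasedFunctor N (normalizerGerbe J F) where
  obj x := (⟨Ψ.obj x, A x, hA x, hA' x⟩ : NormalizerObj J F)
  map m := ⟨Ψ.map m, hmap m⟩
  map_id x := Subtype.ext (Ψ.map_id x)
  map_comp l m := Subtype.ext (Ψ.map_comp l m)
  w := Ψ.w

/-- Every normalizer of `F` is equivalent over the target to the gerbe of subsheaves which are
locally images. -/
theorem IsNormalizer.exists_comparison (hG : IsGerbe J G) (hH : IsGerbe J H)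
    {F : BasedFunctor G H} (hF : F.toFunctor.Faithful) {Φ : BasedFunctor G N}
    {Ψ : BasedFunctor N H} (θ : BasedFunctor.comp Φ Ψ ≅ F) (hN : IsNormalizer J Φ Ψ) :
    ∃ K : BasedFunctor N (normalizerGerbe J F), K.toFunctor.Full ∧ K.toFunctor.Faithful ∧
      BasedFunctor.comp K (normalizerForget J F) = Ψ ∧
      (∀ m : (normalizerGerbe J F).obj, ∃ (x : N.obj) (i : K.obj x ≅ m),
        (normalizerGerbe J F).p.IsHomLift (𝟙 ((normalizerGerbe J F).p.obj m)) i.hom) ∧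
      ∃ t : BasedFunctor.comp Φ K ≅ toNormalizer F hF, ∀ s,
        HEq ((normalizerForget J F).map (t.hom.toNatTrans.app s)) (θ.hom.toNatTrans.app s) := by
  have := hN.isGerbe
  have : IsFiberedInGroupoids G := IsStackInGroupoids.toIsFiberedInGroupoids J
  have : IsFiberedInGroupoids H := IsStackInGroupoids.toIsFiberedInGroupoids J
  have := normalizerGerbe_isStackInGroupoids (J := J) F
  obtain ⟨A, hA, hA', hAΦ, hAmap⟩ := hN.exists_family hG hH
  let K : BasedFunctor N (normalizerGerbe J F) := comparison F Ψ A hA (fun x => (hA' x).of_iso θ)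
    (fun {x y} m => (hAmap x y _).1 ⟨m, rfl⟩)
  have hK : K.toFunctor.Full := ⟨fun {x y} l => by
    obtain ⟨m, hm⟩ := (hAmap x y l.1).2 l.2
    exact ⟨m, Subtype.ext hm⟩⟩
  have hK' : K.toFunctor.Faithful :=
    ⟨fun {_ _} _ _ h => hN.faithful_right.map_injective (congrArg Subtype.val h)⟩
  have e1 : ∀ s, A (Φ.obj s) = (AutSub.image F s).restrict (θ.hom.toNatTrans.app s) := fun s =>
    (hAΦ s).trans (AutSub.image_eq_restrict_app θ s)
  have e2 : ∀ s, AutSub.image F s = (A (Φ.obj s)).restrict (θ.inv.toNatTrans.app s) := fun s => by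
    rw [hAΦ s]
    exact AutSub.image_eq_restrict_app θ.symm s
  refine ⟨K, hK, hK', rfl, fun m => ?_, ?_⟩
  · refine exists_iso_obj_of_locally (J := J) K hK hK' m ?_
    have h1 : Locally J ((normalizerForget J F).obj m) (fun _ χ => ∃ (s : G.obj)
      (w : _ ⟶ F.obj s), (NormalizerObj.sub m).restrict χ = (AutSub.image F s).restrict w) :=
      NormalizerObj.locallyImage m
    refine (h1.comap (normalizerForget J F)).mono ?_
    rintro c φ ⟨s, w, hw⟩
    refine ⟨Φ.obj s, ⟨⟨w ≫ θ.inv.toNatTrans.app s, ?_⟩⟩⟩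
    refine φ.2.trans (hw.trans ?_)
    rw [e2 s]
    exact AutSub.restrict_restrict _ _ _
  · let t₀ : ∀ s, K.obj (Φ.obj s) ≅ (toNormalizer (J := J) F hF).obj s := fun s =>
      { hom := ⟨θ.hom.toNatTrans.app s, e1 s⟩
        inv := ⟨θ.inv.toNatTrans.app s, e2 s⟩
        hom_inv_id := Subtype.ext (app_hom_comp_inv θ s)
        inv_hom_id := Subtype.ext (app_inv_comp_hom θ s) }
    exact ⟨BasedNatIso.mkNatIso (NatIso.ofComponents t₀
      (fun l => Subtype.ext (θ.hom.toNatTrans.naturality l)))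
      (fun s => (normalizerGerbe_isHomLift_iff _ _).2 (θ.hom.isHomLift' s)), fun s => HEq.rfl⟩

end Comparison

/-- The automorphism sheaves of a morphism locally equivalent to `F` are locally those of `F`. -/
theorem LocallyEquivalent.locallyImage {G : BasedCategory.{v₁, u₁} C}
    {G' : BasedCategory.{v₂, u₂} C} {H : BasedCategory.{v₃, u₃} C} {F : BasedFunctor G H}
    {F' : BasedFunctor G' H} (hG : IsGerbe J G) (hG' : IsGerbe J G') (hH : IsGerbe J H)
    (h : LocallyEquivalent J F F') (s' : G'.obj) : LocallyImage J F (AutSub.image F' s') := by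
  have : IsFiberedInGroupoids G' := IsStackInGroupoids.toIsFiberedInGroupoids J
  have : IsFiberedInGroupoids H := IsStackInGroupoids.toIsFiberedInGroupoids J
  have h1 : ∀ (S : C) (s : G.obj) (t : G'.obj) (α : F.obj s ≅ F'.obj t),
      H.p.IsHomLift (𝟙 S) α.hom → LocallyImage J F (AutSub.image F' t) := by
    intro S s t α hα
    obtain ⟨R, hR, H⟩ := h S s t α hα
    refine ⟨R, hR, fun c χ hχ => ?_⟩
    obtain ⟨β, hβ⟩ := H χ hχ
    -- Conjugation by an isomorphism is, by definition, restriction along its inverse, so local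
    -- conjugacy exhibits a local model from `G`.
    replace hβ : (((AutSub.image F s).restrict α.inv).restrict χ).restrict
      (Iso.inv (β.1 : c ≅ c)) = (AutSub.image F' t).restrict χ := hβ
    rw [AutSub.restrict_restrict, AutSub.restrict_restrict] at hβ
    exact ⟨s, _, hβ.symm⟩
  obtain ⟨R, hR, H⟩ := exists_sieve_map hG hH F (F'.obj s') (F'.w_obj s')
  have h2 : Locally J (F'.obj s') (fun d χ => ∃ (t : G'.obj) (σ : t ⟶ s') (ι : d ≅ F'.obj t),
      ι.hom ≫ F'.map σ = χ ∧ LocallyImage J F (AutSub.image F' t)) :=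
    Locally.of_sieve (F'.w_obj s') hR fun T f hf d χ hχ => by
      obtain ⟨s, ρ, hρ⟩ := H f hf
      obtain ⟨t, σ, hσ⟩ := exists_isHomLift (X := G') f rfl
      obtain ⟨ι, -, hι⟩ := exists_iso_factor f (F'.map σ) χ
      obtain ⟨α, hα, -⟩ := exists_iso_factor f (F'.map σ) ρ
      exact ⟨t, σ, ι, hι, h1 T s t α hα⟩
  refine h2.trans ?_
  rintro d _ ⟨t, σ, ι, rfl, ht⟩
  refine (ht.restrict ι.hom).mono ?_
  rintro e l ⟨s, w, hw⟩
  refine ⟨s, w, ?_⟩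
  rw [← hw, AutSub.image_eq_restrict F' σ, AutSub.restrict_restrict, AutSub.restrict_restrict,
    Category.assoc]

end GerbeNormalizer

theorem theorem1p4 {C : Type u} [Category.{v} C] (J : GrothendieckTopology C)
    {G : BasedCategory.{v₁, u₁} C} {H : BasedCategory.{v₂, u₂} C} (hG : IsGerbe J G)
    (hH : IsGerbe J H) (F : BasedFunctor G H) (hF : F.toFunctor.Faithful) :
    -- existence
    (∃ (N : BasedCategory.{v₂, max u₂ v₂} C) (Φ : BasedFunctor G N) (Ψ : BasedFunctor N H),
      Nonempty (BasedFunctor.comp Φ Ψ ≅ F) ∧ IsNormalizer J Φ Ψ) ∧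
    -- uniqueness, compatibly with the given factorizations
    (∀ (N : BasedCategory.{v₃, u₃} C) (Φ : BasedFunctor G N) (Ψ : BasedFunctor N H)
      (θ : BasedFunctor.comp Φ Ψ ≅ F)
      (N' : BasedCategory.{v₄, u₄} C) (Φ' : BasedFunctor G N') (Ψ' : BasedFunctor N' H)
      (θ' : BasedFunctor.comp Φ' Ψ' ≅ F),
      IsNormalizer J Φ Ψ → IsNormalizer J Φ' Ψ' →
      ∃ (E : BasedFunctor N N') (a : BasedFunctor.comp Φ E ≅ Φ')
        (b : BasedFunctor.comp E Ψ' ≅ Ψ), IsEquivalenceOver E ∧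
        BasedCategory.whiskerLeft Φ b.hom ≫ θ.hom =
          BasedCategory.whiskerRight a.hom Ψ' ≫ θ'.hom) ∧
    -- locally equivalent morphisms have the same normalizer
    (∀ (N : BasedCategory.{v₃, u₃} C) (Φ : BasedFunctor G N) (Ψ : BasedFunctor N H),
      Nonempty (BasedFunctor.comp Φ Ψ ≅ F) → IsNormalizer J Φ Ψ →
      ∀ (G' : BasedCategory.{v₅, u₅} C) (F' : BasedFunctor G' H), IsGerbe J G' →
        F'.toFunctor.Faithful → LocallyEquivalent J F F' →
        ∃ Φ' : BasedFunctor G' N,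
          Nonempty (BasedFunctor.comp Φ' Ψ ≅ F') ∧ IsNormalizer J Φ' Ψ) := by
  have : IsFiberedInGroupoids G := IsStackInGroupoids.toIsFiberedInGroupoids J
  have : IsFiberedInGroupoids H := IsStackInGroupoids.toIsFiberedInGroupoids J
  refine ⟨⟨normalizerGerbe J F, toNormalizer F hF, normalizerForget J F, ⟨Iso.refl F⟩,
    isNormalizer_normalizerGerbe hG hH F hF⟩, ?_, ?_⟩
  · intro N Φ Ψ θ N' Φ' Ψ' θ' hN hN'
    -- Replacing `Ψ` by the composite of `K` with the projection turns the heterogeneous equalities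
    -- in `ht` into ordinary ones.
    obtain ⟨K, hK, hK', rfl, hKs, t, ht⟩ := hN.exists_comparison hG hH hF θ
    obtain ⟨L, hL, hL', rfl, hLs, t', ht'⟩ := hN'.exists_comparison hG hH hF θ'
    obtain ⟨E, ⟨b⟩⟩ := exists_comp_iso K L hL hL' fun x => by
      obtain ⟨y, i, hi⟩ := hLs (K.obj x)
      rw [K.w_obj] at hi
      exact ⟨y, i, hi⟩
    obtain ⟨E', ⟨b'⟩⟩ := exists_comp_iso L K hK hK' fun x => by
      obtain ⟨y, i, hi⟩ := hKs (L.obj x)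
      rw [L.w_obj] at hi
      exact ⟨y, i, hi⟩
    -- Here `a` is the lift along `L` of the composite of `b`, `t` and the inverse of `t'`. As `t`
    -- and `t'` lie over `θ` and `θ'`, the required compatibility follows by cancelling `t'`.
    obtain ⟨a, ha⟩ := exists_whiskerRight_eq L hL hL' (E := BasedFunctor.comp Φ E) (E' := Φ')
      ((isoWhiskerLeft Φ b).trans (t.trans t'.symm))
    obtain ⟨c, -⟩ := exists_whiskerRight_eq K hK hK' (E := BasedFunctor.comp E E')
      (E' := BasedFunctor.id N) ((isoWhiskerLeft E b').trans b)
    obtain ⟨c', -⟩ := exists_whiskerRight_eq L hL hL' (E := BasedFunctor.comp E' E)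
      (E' := BasedFunctor.id N') ((isoWhiskerLeft E' b).trans b')
    refine ⟨E, a, isoWhiskerRight b (normalizerForget J F), ⟨E', ⟨c⟩, ⟨c'⟩⟩, ?_⟩
    apply BasedNatTrans.homCategory.ext
    apply NatTrans.ext
    funext s
    have h1 : ∀ {x y z w : (normalizerGerbe J F).obj} (l : x ⟶ w) (p : x ⟶ y) (q : y ⟶ z)
        (i : z ⟶ w) (j : w ⟶ z), i ≫ j = 𝟙 z → l = p ≫ q ≫ i →
        (normalizerForget J F).map p ≫ (normalizerForget J F).map q =
          (normalizerForget J F).map l ≫ (normalizerForget J F).map j := by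
      rintro x y z w l p q i j hij rfl
      rw [← Functor.map_comp, ← Functor.map_comp]
      simp [hij]
    have h2 := h1 _ _ _ _ _ (app_inv_comp_hom t' s) (congrArg (fun α => α.toNatTrans.app s) ha)
    exact (congrArg (_ ≫ ·) (eq_of_heq (ht s)).symm).trans
      (h2.trans (congrArg (_ ≫ ·) (eq_of_heq (ht' s))))
  · rintro N Φ Ψ ⟨θ⟩ hN G' F' hG' hF' hFF'
    have : IsFiberedInGroupoids G' := IsStackInGroupoids.toIsFiberedInGroupoids J
    have := hN.isGerbe
    have : IsFiberedInGroupoids N := IsStackInGroupoids.toIsFiberedInGroupoids J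
    obtain ⟨K, hK, hK', rfl, hKs, -⟩ := hN.exists_comparison hG hH hF θ
    let P : BasedFunctor G' (normalizerGerbe J F) :=
      liftNormalizer F F' hF' (hFF'.locallyImage hG hG' hH)
    obtain ⟨Φ', ⟨η⟩⟩ := exists_comp_iso P K hK hK' fun x => by
      obtain ⟨y, i, hi⟩ := hKs (P.obj x)
      rw [P.w_obj] at hi
      exact ⟨y, i, hi⟩
    let η' : BasedFunctor.comp Φ' (BasedFunctor.comp K (normalizerForget J F)) ≅ F' :=
      isoWhiskerRight η (normalizerForget J F)
    refine ⟨Φ', ⟨η'⟩, hN.isGerbe, faithful_of_comp_iso η' hF', hN.faithful_right, fun s => ?_⟩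
    -- Fullness of `K` gives `N` the same liftable arrows as the pairs, so the automorphism sheaf of
    -- `Φ'.obj s` is the normalizer of the subsheaf carried by its image under `K`; `η` identifies
    -- that subsheaf with the automorphism sheaf of `s`.
    have e1 := AutSub.image_eq_normalizer (BasedFunctor.comp K (normalizerForget J F))
      (fun x => NormalizerObj.sub (K.obj x)) (fun x y l => by
        refine Iff.trans ⟨?_, ?_⟩ (exists_normalizerForget_map_eq_iff F (K.obj x) (K.obj y) l)
        · rintro ⟨m, rfl⟩
          exact ⟨K.map m, rfl⟩
        · rintro ⟨m, rfl⟩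
          obtain ⟨n, rfl⟩ := K.toFunctor.map_surjective m
          exact ⟨n, rfl⟩) (Φ'.obj s)
    refine e1.trans (congrArg AutSub.normalizer ?_)
    exact (η.hom.toNatTrans.app s).2.trans (AutSub.image_eq_restrict_app η' s).symm
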